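/- All graphs are finite, simple and undirected, and $N(s)$ denotes the set of neighbours of $s$. A \emph{hole} is an induced cycle of length at least $4$. For $d\ge 2$, a \emph{$\dag$-AW} is the graph consisting of an induced path $b_0b_1\cdots b_{d+1}$, a vertex $c$ adjacent exactly to $b_1,\dots,b_d$ and $s$, and a vertex $s$ adjacent only to $c$. For $d\ge 1$, a \emph{$\ddag$-AW} is the graph consisting of an induced path $b_0b_1\cdots b_{d+1}$, two adjacent vertices $c_1,c_2$, where among the path vertices $c_1$ is adjacent exactly to $b_0,\dots,b_d$ and $c_2$ exactly to $b_1,\dots,b_{d+1}$, and a vertex $s$ adjacent exactly to $c_1$ and $c_2$. In both cases $\{b_1,\dots,b_d\}$ is the \emph{base}; if $d>3$ the graph is called \emph{long} and $s$ is its \emph{shallow terminal}. The \emph{small} asteroidal witnesses (AWs) are the $\dag$- and $\ddag$-AWs with $d\le 3$, the long claw (the claw $K_{1,3}$ with every edge subdivided once), and the whipping top (a path on five vertices, a vertex adjacent to all five of them, and a vertex adjacent only to the middle vertex of the path). The AWs are the small AWs and the long $\dag$- and $\ddag$-AWs. A graph is \emph{reduced} if it contains no hole and no small AW as an induced subgraph;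 thus every AW contained in a reduced graph as an induced subgraph is long. For a reduced graph $G$, let $ST(G)$ be the set of all vertices of $G$ that are the shallow terminal of some AW contained in $G$ as an induced subgraph. Lemma. Let $G$ be a reduced graph and let $s\in ST(G)$. Then $G$ contains, as an induced subgraph, an AW whose shallow terminal is $s$ and whose base is completely connected to $N(s)\setminus ST(G)$, i.e., every base vertex is adjacent to every vertex of $N(s)\setminus ST(G)$. Moreover, there is an algorithm that, given any reduced graph $G$ and any $s\in ST(G)$, finds such an AW in time polynomial in the number of vertices of $G$. -/

import Mathlib

namespace IntervalCompletion

/-! ### Asteroidal witnesses -/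

/-- Vertices of the `†`-AW: shallow terminal `s`, center `c`, and the path `b_0, …, b_{d+1}`. -/
inductive DagVertex (d : ℕ) : Type
  | s : DagVertex d
  | c : DagVertex d
  | b (i : Fin (d + 2)) : DagVertex d

/-- The edges of the `†`-AW, each in one orientation. -/
def dagRel (d : ℕ) : DagVertex d → DagVertex d → Prop
  | .s, .c => True
  | .c, .b i => 1 ≤ (i : ℕ) ∧ (i : ℕ) ≤ d
  | .b i, .b j => (i : ℕ) + 1 = j
  | _, _ => False

/-- The `†`-AW with `d` base vertices `b_1, …, b_d` and base terminals `b_0`, `b_{d+1}`. -/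
def dagGraph (d : ℕ) : SimpleGraph (DagVertex d) := SimpleGraph.fromRel (dagRel d)

/-- Vertices of the `‡`-AW: shallow terminal `s`, centers `c₁`, `c₂`, and the path
`b_0, …, b_{d+1}`. -/
inductive DdagVertex (d : ℕ) : Type
  | s : DdagVertex d
  | c₁ : DdagVertex d
  | c₂ : DdagVertex d
  | b (i : Fin (d + 2)) : DdagVertex d

/-- The edges of the `‡`-AW, each in one orientation. -/
def ddagRel (d : ℕ) : DdagVertex d → DdagVertex d → Prop
  | .s, .c₁ => True
  | .s, .c₂ => True
  | .c₁, .c₂ => True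
  | .c₁, .b i => (i : ℕ) ≤ d
  | .c₂, .b i => 1 ≤ (i : ℕ)
  | .b i, .b j => (i : ℕ) + 1 = j
  | _, _ => False

/-- The `‡`-AW with `d` base vertices `b_1, …, b_d` and base terminals `b_0`, `b_{d+1}`. -/
def ddagGraph (d : ℕ) : SimpleGraph (DdagVertex d) := SimpleGraph.fromRel (ddagRel d)

/-- The long claw: the claw with each edge subdivided once. -/
def longClaw : SimpleGraph (Fin 7) :=
  SimpleGraph.fromEdgeSet {s(0, 1), s(1, 2), s(0, 3), s(3, 4), s(0, 5), s(5, 6)}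

/-- The whipping top: the path `0 1 2 3 4`, a vertex `5` adjacent to the whole path, and a
vertex `6` adjacent to the middle vertex `2` of the path only. -/
def whippingTop : SimpleGraph (Fin 7) :=
  SimpleGraph.fromEdgeSet
    {s(0, 1), s(1, 2), s(2, 3), s(3, 4), s(5, 0), s(5, 1), s(5, 2), s(5, 3), s(5, 4), s(6, 2)}

universe u

/-- `G` contains a hole: an induced cycle of length at least `4`. -/
def HasHole {V : Type u} (G : SimpleGraph V) : Prop :=
  ∃ k : ℕ, 4 ≤ k ∧ (SimpleGraph.cycleGraph k).IsIndContained G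

/-- `G` contains a small AW as an induced subgraph: a long claw, a whipping top, a `†`-AW with
`2 ≤ d ≤ 3`, or a `‡`-AW with `1 ≤ d ≤ 3`. -/
def HasSmallAW {V : Type u} (G : SimpleGraph V) : Prop :=
  longClaw.IsIndContained G ∨ whippingTop.IsIndContained G ∨
    (∃ d : ℕ, 2 ≤ d ∧ d ≤ 3 ∧ (dagGraph d).IsIndContained G) ∨
    (∃ d : ℕ, 1 ≤ d ∧ d ≤ 3 ∧ (ddagGraph d).IsIndContained G)

/-- A graph is reduced if it contains no hole and no small AW. -/
def IsReduced {V : Type u} (G : SimpleGraph V) : Prop := ¬ HasHole G ∧ ¬ HasSmallAW G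

/-- A long AW of `G` (a `†`- or `‡`-AW with `d > 3`, as an induced subgraph of `G`), together with
its labelling.  In a reduced graph every AW is of this form. -/
inductive LongAW {V : Type u} (G : SimpleGraph V) : Type u
  | dag (d : ℕ) (hd : 3 < d) (f : dagGraph d ↪g G) : LongAW G
  | ddag (d : ℕ) (hd : 3 < d) (f : ddagGraph d ↪g G) : LongAW G

namespace LongAW

variable {V : Type u} {G : SimpleGraph V}

/-- The number of base vertices. -/
def d : LongAW G → ℕ
  | .dag d _ _ => d
  | .ddag d _ _ => d

/-- The shallow terminal. -/
def shallowTerminal : LongAW G → V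
  | .dag _ _ f => f .s
  | .ddag _ _ f => f .s

/-- The first center (the only center of a `†`-AW). -/
def c₁ : LongAW G → V
  | .dag _ _ f => f .c
  | .ddag _ _ f => f .c₁

/-- The second center (the only center of a `†`-AW). -/
def c₂ : LongAW G → V
  | .dag _ _ f => f .c
  | .ddag _ _ f => f .c₂

/-- The path `b_0, b_1, …, b_{d+1}` from one base terminal to the other. -/
def path : (W : LongAW G) → Fin (W.d + 2) → V
  | .dag _ _ f => fun i => f (.b i)
  | .ddag _ _ f => fun i => f (.b i)

/-- The base `{b_1, …, b_d}`: the inner vertices of the path. -/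
def base (W : LongAW G) : Set V :=
  {v | ∃ i : Fin (W.d + 2), 1 ≤ (i : ℕ) ∧ (i : ℕ) ≤ W.d ∧ v = W.path i}

end LongAW

/-- The set `ST(G)` of shallow terminals of the AWs of a reduced graph. -/
def ST {V : Type u} (G : SimpleGraph V) : Set V :=
  {v | ∃ W : LongAW G, W.shallowTerminal = v}

/-- `W` is an AW with shallow terminal `s` whose base is completely connected to
`N(s) \ ST(G)`. -/
def IsGoodAW {V : Type u} (G : SimpleGraph V) (s : V) (W : LongAW G) : Prop :=
  W.shallowTerminal = s ∧ ∀ v ∈ W.base, ∀ x ∈ G.neighborSet s \ ST G, G.Adj v x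

/-! ### A random access machine with step count

Programs are structured programs over finitely many registers and arrays that hold natural
numbers.  The available operations are constants, reading, addition, truncated subtraction and
comparison, each at unit cost.  (There is no multiplication, so a unit of cost at most doubles the
largest number in store, and polynomial time agrees with that of Turing machines.) -/

/-- A machine state: contents of the registers, and of the cells of the arrays. -/
structure State where
  reg : ℕ → ℕ
  arr : ℕ → ℕ → ℕ

/-- Expressions. -/
inductive Expr : Type
  | const (k : ℕ) : Expr
  | reg (x : ℕ) : Expr
  /-- the cell of array `a` at the index given by the expression `e` -/
  | read (a : ℕ) (e : Expr) : Expr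
  | add (e₁ e₂ : Expr) : Expr
  | sub (e₁ e₂ : Expr) : Expr
  /-- `1` if `e₁ < e₂`, and `0` otherwise -/
  | lt (e₁ e₂ : Expr) : Expr
  /-- `1` if `e₁ = e₂`, and `0` otherwise -/
  | eq (e₁ e₂ : Expr) : Expr

/-- The value of an expression in a state. -/
def Expr.eval (σ : State) : Expr → ℕ
  | .const k => k
  | .reg x => σ.reg x
  | .read a e => σ.arr a (e.eval σ)
  | .add e₁ e₂ => e₁.eval σ + e₂.eval σ
  | .sub e₁ e₂ => e₁.eval σ - e₂.eval σ
  | .lt e₁ e₂ => if e₁.eval σ < e₂.eval σ then 1 else 0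
  | .eq e₁ e₂ => if e₁.eval σ = e₂.eval σ then 1 else 0

/-- The number of steps taken to evaluate an expression: one for each operation in it. -/
def Expr.cost : Expr → ℕ
  | .const _ => 1
  | .reg _ => 1
  | .read _ e => e.cost + 1
  | .add e₁ e₂ => e₁.cost + e₂.cost + 1
  | .sub e₁ e₂ => e₁.cost + e₂.cost + 1
  | .lt e₁ e₂ => e₁.cost + e₂.cost + 1
  | .eq e₁ e₂ => e₁.cost + e₂.cost + 1

/-- Programs. -/
inductive Prog : Type
  | skip : Prog
  /-- assign the value of `e` to register `x` -/
  | assign (x : ℕ) (e : Expr) : Prog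
  /-- write the value of `e` into array `a` at the index given by `i` -/
  | write (a : ℕ) (i e : Expr) : Prog
  | seq (P Q : Prog) : Prog
  /-- run `P` if `e` is nonzero, and `Q` otherwise -/
  | branch (e : Expr) (P Q : Prog) : Prog
  /-- repeat `P` as long as `e` is nonzero -/
  | loop (e : Expr) (P : Prog) : Prog

/-- `Exec P σ t τ`: started in state `σ`, the program `P` halts after exactly `t` steps, in
state `τ`. -/
inductive Exec : Prog → State → ℕ → State → Prop
  | skip (σ : State) : Exec .skip σ 1 σ
  | assign (σ : State) (x : ℕ) (e : Expr) :
      Exec (.assign x e) σ (e.cost + 1) ⟨Function.update σ.reg x (e.eval σ), σ.arr⟩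
  | write (σ : State) (a : ℕ) (i e : Expr) :
      Exec (.write a i e) σ (i.cost + e.cost + 1)
        ⟨σ.reg, Function.update σ.arr a (Function.update (σ.arr a) (i.eval σ) (e.eval σ))⟩
  | seq {P Q : Prog} {σ τ ρ : State} {t u : ℕ} (hP : Exec P σ t τ) (hQ : Exec Q τ u ρ) :
      Exec (.seq P Q) σ (t + u) ρ
  | branch_true {e : Expr} {P Q : Prog} {σ τ : State} {t : ℕ} (he : e.eval σ ≠ 0)
      (hP : Exec P σ t τ) : Exec (.branch e P Q) σ (e.cost + 1 + t) τ
  | branch_false {e : Expr} {P Q : Prog} {σ τ : State} {t : ℕ} (he : e.eval σ = 0)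
      (hQ : Exec Q σ t τ) : Exec (.branch e P Q) σ (e.cost + 1 + t) τ
  | loop_done {e : Expr} {P : Prog} {σ : State} (he : e.eval σ = 0) :
      Exec (.loop e P) σ (e.cost + 1) σ
  | loop_step {e : Expr} {P : Prog} {σ τ ρ : State} {t u : ℕ} (he : e.eval σ ≠ 0)
      (hP : Exec P σ t τ) (hL : Exec (.loop e P) τ u ρ) :
      Exec (.loop e P) σ (e.cost + 1 + t + u) ρ

open Classical in
/-- The initial state on input `(G, s)`: register `0` holds the number `n` of vertices, register
`1` holds `s`, array `0` holds the adjacency matrix of `G` row by row (the entry of the pair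
`(i, j)` in cell `i * n + j`), and everything else is `0`. -/
noncomputable def inputState {n : ℕ} (G : SimpleGraph (Fin n)) (s : Fin n) : State where
  reg x := if x = 0 then n else if x = 1 then (s : ℕ) else 0
  arr a m :=
    if a = 0 ∧ ∃ i j : Fin n, m = (i : ℕ) * n + (j : ℕ) ∧ G.Adj i j then 1 else 0

/-- A long AW written as the list `d, s, c₁, c₂, b_0, …, b_{d+1}` (with `c₁ = c₂` for a
`†`-AW). -/
def LongAW.toList {n : ℕ} {G : SimpleGraph (Fin n)} (W : LongAW G) : List ℕ :=
  [W.d, (W.shallowTerminal : ℕ), (W.c₁ : ℕ), (W.c₂ : ℕ)] ++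
    List.ofFn (fun i : Fin (W.d + 2) => (W.path i : ℕ))

/-- The output of a computation, in array `1` of the final state, is the list `L`. -/
def State.Outputs (σ : State) (L : List ℕ) : Prop :=
  ∀ i : Fin L.length, σ.arr 1 i = L.get i

end IntervalCompletion

/-! Among the long AWs with shallow terminal `s`, take one with the fewest base vertices, and let
`x` be a neighbor of `s` outside `ST(G)` that is not a center. Since `G` is reduced, `x` is adjacent
to both centers. It has a neighbor on the path, as otherwise it could take the place of `s` and
would be a shallow terminal itself. Since `G` has no hole, its neighbors on the path form an
interval, and if this interval missed a base vertex, then `x` could serve as a center of an AW with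
shallow terminal `s` and a shorter base.

So it suffices to compute a shortest AW for `s`. For all choices of the centers and of the two ends
of the path, a breadth-first search finds a shortest path between the ends whose inner vertices
satisfy the adjacencies required of base vertices; being shortest, it is induced.
-/

namespace IntervalCompletion

section InducedSubgraphs

variable {V : Type*} {G : SimpleGraph V}

theorem adj_iff_of_lt {n : ℕ} {H : SimpleGraph (Fin n)} {f : Fin n → V}
    (h : ∀ i j, i < j → (G.Adj (f i) (f j) ↔ H.Adj i j)) (i j : Fin n) :
    G.Adj (f i) (f j) ↔ H.Adj i j := by
  rcases lt_trichotomy i j with hij | rfl | hij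
  · exact h i j hij
  · simp only [SimpleGraph.irrefl]
  · rw [G.adj_comm, H.adj_comm, h j i hij]

theorem isIndContained_of_adj_iff {W : Type*} {H : SimpleGraph W} (f : W → V)
    (htwin : ∀ i j, (∀ k, H.Adj i k ↔ H.Adj j k) → i = j)
    (hadj : ∀ i j, G.Adj (f i) (f j) ↔ H.Adj i j) : H.IsIndContained G :=
  ⟨⟨⟨f, fun i j e => htwin i j fun k => by rw [← hadj, ← hadj, e]⟩, hadj _ _⟩⟩

theorem cycleGraph_adj_iff_of_lt {k : ℕ} {i j : Fin k} (h : i < j) :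
    (SimpleGraph.cycleGraph k).Adj i j ↔ (i : ℕ) + 1 = j ∨ (i : ℕ) = 0 ∧ (j : ℕ) + 1 = k := by
  rw [SimpleGraph.cycleGraph_adj', Fin.sub_val_of_le h.le, Fin.coe_sub_iff_lt.2 h]
  omega

theorem HasHole.of_injective {k : ℕ} (hk : 4 ≤ k) {f : Fin k → V} (hf : Function.Injective f)
    (hadj : ∀ i j : Fin k, i < j →
      (G.Adj (f i) (f j) ↔ (i : ℕ) + 1 = j ∨ (i : ℕ) = 0 ∧ (j : ℕ) + 1 = k)) : HasHole G :=
  ⟨k, hk, ⟨⟨⟨f, hf⟩, adj_iff_of_lt (fun i j h =>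
    (hadj i j h).trans (cycleGraph_adj_iff_of_lt h).symm) _ _⟩⟩⟩

theorem HasHole.of_square {a₀ a₁ a₂ a₃ : V} (h01 : G.Adj a₀ a₁) (h12 : G.Adj a₁ a₂)
    (h23 : G.Adj a₂ a₃) (h30 : G.Adj a₃ a₀) (h02 : ¬ G.Adj a₀ a₂) (h13 : ¬ G.Adj a₁ a₃)
    (n02 : a₀ ≠ a₂) (n13 : a₁ ≠ a₃) : HasHole G := by
  refine HasHole.of_injective (f := ![a₀, a₁, a₂, a₃]) le_rfl ?_ ?_
  · simp [Function.Injective, Fin.forall_fin_succ, h01.ne, h01.ne', h12.ne, h12.ne', h23.ne,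
      h23.ne', h30.ne, h30.ne', n02, n02.symm, n13, n13.symm]
  · simp [Fin.forall_fin_succ, *, h30.symm]

theorem HasHole.of_pentagon {a₀ a₁ a₂ a₃ a₄ : V} (h01 : G.Adj a₀ a₁) (h12 : G.Adj a₁ a₂)
    (h23 : G.Adj a₂ a₃) (h34 : G.Adj a₃ a₄) (h40 : G.Adj a₄ a₀) (h02 : ¬ G.Adj a₀ a₂)
    (h13 : ¬ G.Adj a₁ a₃) (h24 : ¬ G.Adj a₂ a₄) (h30 : ¬ G.Adj a₃ a₀) (h41 : ¬ G.Adj a₄ a₁) :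
    HasHole G := by
  have hadj : ∀ i j : Fin 5, i < j → (G.Adj (![a₀, a₁, a₂, a₃, a₄] i) (![a₀, a₁, a₂, a₃, a₄] j) ↔
      (i : ℕ) + 1 = j ∨ (i : ℕ) = 0 ∧ (j : ℕ) + 1 = 5) := by
    simp [Fin.forall_fin_succ, *, G.adj_comm a₀ a₃, G.adj_comm a₁ a₄, h40.symm]
  exact ⟨5, by norm_num, isIndContained_of_adj_iff _ (by decide) (adj_iff_of_lt fun i j hij =>
    (hadj i j hij).trans (cycleGraph_adj_iff_of_lt hij).symm)⟩

instance : DecidableRel longClaw.Adj := fun i j =>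
  decidable_of_iff (s(i, j) ∈ ([s(0, 1), s(1, 2), s(0, 3), s(3, 4), s(0, 5), s(5, 6)] :
    List (Sym2 (Fin 7))) ∧ i ≠ j) (by simp [longClaw])

instance : DecidableRel whippingTop.Adj := fun i j =>
  decidable_of_iff (s(i, j) ∈ ([s(0, 1), s(1, 2), s(2, 3), s(3, 4), s(5, 0), s(5, 1), s(5, 2),
    s(5, 3), s(5, 4), s(6, 2)] : List (Sym2 (Fin 7))) ∧ i ≠ j) (by simp [whippingTop])

theorem HasSmallAW.of_longClaw (a₀ a₁ a₂ a₃ a₄ a₅ a₆ : V)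
    (hadj : G.Adj a₀ a₁ ∧ G.Adj a₁ a₂ ∧ G.Adj a₀ a₃ ∧ G.Adj a₃ a₄ ∧ G.Adj a₀ a₅ ∧ G.Adj a₅ a₆)
    (hnot : ¬ G.Adj a₀ a₂ ∧ ¬ G.Adj a₀ a₄ ∧ ¬ G.Adj a₀ a₆ ∧ ¬ G.Adj a₁ a₃ ∧ ¬ G.Adj a₁ a₄ ∧
      ¬ G.Adj a₁ a₅ ∧ ¬ G.Adj a₁ a₆ ∧ ¬ G.Adj a₂ a₃ ∧ ¬ G.Adj a₂ a₄ ∧ ¬ G.Adj a₂ a₅ ∧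
      ¬ G.Adj a₂ a₆ ∧ ¬ G.Adj a₃ a₅ ∧ ¬ G.Adj a₃ a₆ ∧ ¬ G.Adj a₄ a₅ ∧ ¬ G.Adj a₄ a₆) :
    HasSmallAW G := by
  refine Or.inl (isIndContained_of_adj_iff ![a₀, a₁, a₂, a₃, a₄, a₅, a₆] (by decide)
    (adj_iff_of_lt ?_))
  simp [Fin.forall_fin_succ, longClaw, *]

theorem HasSmallAW.of_whippingTop (a₀ a₁ a₂ a₃ a₄ a₅ a₆ : V)
    (hadj : G.Adj a₀ a₁ ∧ G.Adj a₁ a₂ ∧ G.Adj a₂ a₃ ∧ G.Adj a₃ a₄ ∧ G.Adj a₀ a₅ ∧ G.Adj a₁ a₅ ∧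
      G.Adj a₂ a₅ ∧ G.Adj a₃ a₅ ∧ G.Adj a₄ a₅ ∧ G.Adj a₂ a₆)
    (hnot : ¬ G.Adj a₀ a₂ ∧ ¬ G.Adj a₀ a₃ ∧ ¬ G.Adj a₀ a₄ ∧ ¬ G.Adj a₀ a₆ ∧ ¬ G.Adj a₁ a₃ ∧
      ¬ G.Adj a₁ a₄ ∧ ¬ G.Adj a₁ a₆ ∧ ¬ G.Adj a₂ a₄ ∧ ¬ G.Adj a₃ a₆ ∧ ¬ G.Adj a₄ a₆ ∧
      ¬ G.Adj a₅ a₆) :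
    HasSmallAW G := by
  refine Or.inr (Or.inl (isIndContained_of_adj_iff ![a₀, a₁, a₂, a₃, a₄, a₅, a₆] (by decide)
    (adj_iff_of_lt ?_)))
  simp [Fin.forall_fin_succ, whippingTop, *]

end InducedSubgraphs

/-- `b 0, …, b m` is an induced path of `G`.  (The values of `b` beyond `m` are irrelevant.) -/
structure IsInducedPath {V : Type*} (G : SimpleGraph V) (m : ℕ) (b : ℕ → V) : Prop where
  injOn : ∀ i ≤ m, ∀ j ≤ m, b i = b j → i = j
  adj_iff : ∀ i ≤ m, ∀ j ≤ m, (G.Adj (b i) (b j) ↔ i + 1 = j ∨ j + 1 = i)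

namespace IsInducedPath

variable {V V' : Type*} {G : SimpleGraph V} {G' : SimpleGraph V'} {m : ℕ} {b : ℕ → V} {x : V}

theorem adj_succ (h : IsInducedPath G m b) {i : ℕ} (hi : i < m) : G.Adj (b i) (b (i + 1)) :=
  (h.adj_iff i hi.le (i + 1) hi).2 (Or.inl rfl)

theorem map (h : IsInducedPath G m b) (f : G ↪g G') : IsInducedPath G' m (f ∘ b) where
  injOn i hi j hj e := h.injOn i hi j hj (f.injective e)
  adj_iff i hi j hj := f.map_adj_iff.trans (h.adj_iff i hi j hj)

theorem reverse (h : IsInducedPath G m b) : IsInducedPath G m (fun i => b (m - i)) where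
  injOn i hi j hj e := by
    have := h.injOn (m - i) (by omega) (m - j) (by omega) e
    omega
  adj_iff i hi j hj := by
    rw [h.adj_iff (m - i) (by omega) (m - j) (by omega)]
    omega

theorem segment (h : IsInducedPath G m b) {p l : ℕ} (hl : p + l ≤ m) :
    IsInducedPath G l (fun i => b (p + i)) where
  injOn i hi j hj e := by
    have := h.injOn (p + i) (by omega) (p + j) (by omega) e
    omega
  adj_iff i hi j hj := by
    rw [h.adj_iff (p + i) (by omega) (p + j) (by omega)]
    omega

theorem hasHole (h : IsInducedPath G m b) (hm : 2 ≤ m) (hx : ∀ i ≤ m, x ≠ b i)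
    (h₀ : G.Adj x (b 0)) (h₁ : G.Adj x (b m)) (h₂ : ∀ i, 0 < i → i < m → ¬ G.Adj x (b i)) :
    HasHole G := by
  have hadj : ∀ i ≤ m, (G.Adj (b i) x ↔ i = 0 ∨ i = m) := by
    intro i hi
    rw [G.adj_comm]
    refine ⟨fun e => ?_, ?_⟩
    · by_contra
      exact h₂ i (by omega) (by omega) e
    · rintro (rfl | rfl) <;> assumption
  refine HasHole.of_injective (k := m + 2) (f := fun i => if (i : ℕ) ≤ m then b i else x)
    (by omega) ?_ ?_
  · intro i j e
    have := h.injOn i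
    grind
  · intro i j hij
    have hi : (i : ℕ) ≤ m := by omega
    by_cases hj : (j : ℕ) ≤ m <;> simp only [hi, hj, if_true, if_false]
    · rw [h.adj_iff i hi j hj]; omega
    · rw [hadj i hi]; omega

theorem exists_adj_between (h : IsInducedPath G m b) (hG : ¬ HasHole G) (hx : ∀ i ≤ m, x ≠ b i)
    {i j : ℕ} (hij : i + 1 < j) (hj : j ≤ m) (hxi : G.Adj x (b i)) (hxj : G.Adj x (b j)) :
    ∃ k, i < k ∧ k < j ∧ G.Adj x (b k) := by
  by_contra! hnone
  refine hG ((h.segment (p := i) (l := j - i) (by omega)).hasHole (x := x) (by omega)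
    (fun t ht => hx _ (by omega)) hxi ?_ fun t ht ht' => hnone _ (by omega) (by omega))
  rwa [Nat.add_sub_cancel' (by omega)]

theorem adj_of_adj_of_adj (h : IsInducedPath G m b) (hG : ¬ HasHole G)
    (hx : ∀ i ≤ m, x ≠ b i) {i j k : ℕ} (hik : i ≤ k) (hkj : k ≤ j) (hj : j ≤ m)
    (hxi : G.Adj x (b i)) (hxj : G.Adj x (b j)) : G.Adj x (b k) := by
  rcases hik.eq_or_lt with rfl | hik'
  · exact hxi
  rcases hkj.eq_or_lt with rfl | hkj'
  · exact hxj
  obtain ⟨l, _, _, hxl⟩ := h.exists_adj_between hG hx (by omega) hj hxi hxj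
  rcases le_total k l with hkl | hlk
  · exact h.adj_of_adj_of_adj hG hx hik hkl (by omega) hxi hxl
  · exact h.adj_of_adj_of_adj hG hx hlk hkj hj hxl hxj
termination_by j - i

theorem exists_interval (h : IsInducedPath G m b) (hG : ¬ HasHole G)
    (hx : ∀ i ≤ m, x ≠ b i) (hex : ∃ i ≤ m, G.Adj x (b i)) :
    ∃ p q, p ≤ q ∧ q ≤ m ∧ ∀ i ≤ m, (G.Adj x (b i) ↔ p ≤ i ∧ i ≤ q) := by
  classical
  obtain ⟨j, hj, hxj⟩ := hex
  have hne : ∃ i, G.Adj x (b i) := ⟨j, hxj⟩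
  have hp := Nat.find_spec hne
  have hq := Nat.findGreatest_spec (P := fun i => G.Adj x (b i)) hj hxj
  have hqm := Nat.findGreatest_le (P := fun i => G.Adj x (b i)) m
  have hjq := Nat.le_findGreatest (P := fun i => G.Adj x (b i)) hj hxj
  exact ⟨_, _, (Nat.find_min' hne hxj).trans hjq, hqm, fun i hi =>
    ⟨fun hxi => ⟨Nat.find_min' hne hxi, Nat.le_findGreatest hi hxi⟩,
      fun hpq => h.adj_of_adj_of_adj hG hx hpq.1 hpq.2 hqm hp hq⟩⟩

end IsInducedPath

/-- The `†`- and `‡`-AWs in one format: shallow terminal `s`, centers `c₁`, `c₂` (equal for a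
`†`-AW) and the path `b 0, …, b (d + 1)`. -/
structure IsAW {V : Type*} (G : SimpleGraph V) (s c₁ c₂ : V) (d : ℕ) (b : ℕ → V) : Prop where
  path : IsInducedPath G (d + 1) b
  s_c₁ : G.Adj s c₁
  s_c₂ : G.Adj s c₂
  s_b : ∀ i ≤ d + 1, ¬ G.Adj s (b i)
  c₁_b : ∀ i, 1 ≤ i → i ≤ d → G.Adj c₁ (b i)
  c₂_b : ∀ i, 1 ≤ i → i ≤ d → G.Adj c₂ (b i)
  c₁_last : ¬ G.Adj c₁ (b (d + 1))
  c₂_first : ¬ G.Adj c₂ (b 0)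
  centers : c₁ = c₂ ∨ G.Adj c₁ c₂ ∧ G.Adj c₁ (b 0) ∧ G.Adj c₂ (b (d + 1))

theorem isAW_dagGraph (d : ℕ) :
    IsAW (dagGraph d) .s .c .c d (fun i => .b (Fin.ofNat (d + 2) i)) := by
  have hval : ∀ i ≤ d + 1, i % (d + 2) = i := fun i hi => Nat.mod_eq_of_lt (by omega)
  refine ⟨⟨fun i hi j hj => ?_, fun i hi j hj => ?_⟩, ?_, ?_, ?_, fun i h1 hi => ?_,
    fun i h1 hi => ?_, ?_, ?_, Or.inl rfl⟩
  · simp [Fin.ext_iff, hval i hi, hval j hj]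
  · simp only [dagGraph, SimpleGraph.fromRel_adj, dagRel, Fin.val_ofNat, hval i hi, hval j hj,
      ne_eq, DagVertex.b.injEq, Fin.ext_iff]
    omega
  · simp [dagGraph, dagRel]
  · simp [dagGraph, dagRel]
  · simp [dagGraph, dagRel]
  · simp [dagGraph, dagRel, hval i (by omega), h1, hi]
  · simp [dagGraph, dagRel, hval i (by omega), h1, hi]
  · simp [dagGraph, dagRel]
  · simp [dagGraph, dagRel]

theorem isAW_ddagGraph (d : ℕ) :
    IsAW (ddagGraph d) .s .c₁ .c₂ d (fun i => .b (Fin.ofNat (d + 2) i)) := by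
  have hval : ∀ i ≤ d + 1, i % (d + 2) = i := fun i hi => Nat.mod_eq_of_lt (by omega)
  refine ⟨⟨fun i hi j hj => ?_, fun i hi j hj => ?_⟩, ?_, ?_, ?_, fun i _ hi => ?_,
    fun i h1 hi => ?_, ?_, ?_, Or.inr ⟨?_, ?_, ?_⟩⟩
  · simp [Fin.ext_iff, hval i hi, hval j hj]
  · simp only [ddagGraph, SimpleGraph.fromRel_adj, ddagRel, Fin.val_ofNat, hval i hi, hval j hj,
      ne_eq, DdagVertex.b.injEq, Fin.ext_iff]
    omega
  · simp [ddagGraph, ddagRel]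
  · simp [ddagGraph, ddagRel]
  · simp [ddagGraph, ddagRel]
  · simp [ddagGraph, ddagRel, hval i (by omega), hi]
  · simp [ddagGraph, ddagRel, hval i (by omega), h1]
  · simp [ddagGraph, ddagRel]
  · simp [ddagGraph, ddagRel]
  · simp [ddagGraph, ddagRel]
  · simp [ddagGraph, ddagRel]
  · simp [ddagGraph, ddagRel]

namespace IsAW

variable {V V' : Type*} {G : SimpleGraph V} {G' : SimpleGraph V'} {s c₁ c₂ x : V} {d : ℕ}
  {b : ℕ → V}

theorem map (h : IsAW G s c₁ c₂ d b) (f : G ↪g G') :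
    IsAW G' (f s) (f c₁) (f c₂) d (f ∘ b) where
  path := h.path.map f
  s_c₁ := f.map_adj_iff.2 h.s_c₁
  s_c₂ := f.map_adj_iff.2 h.s_c₂
  s_b i hi := f.map_adj_iff.not.2 (h.s_b i hi)
  c₁_b i h1 hi := f.map_adj_iff.2 (h.c₁_b i h1 hi)
  c₂_b i h1 hi := f.map_adj_iff.2 (h.c₂_b i h1 hi)
  c₁_last := f.map_adj_iff.not.2 h.c₁_last
  c₂_first := f.map_adj_iff.not.2 h.c₂_first
  centers := by simpa only [f.injective.eq_iff, f.map_adj_iff, Function.comp_apply] using h.centers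

theorem reverse (h : IsAW G s c₁ c₂ d b) : IsAW G s c₂ c₁ d (fun i => b (d + 1 - i)) where
  path := h.path.reverse
  s_c₁ := h.s_c₂
  s_c₂ := h.s_c₁
  s_b i _ := h.s_b _ (by omega)
  c₁_b i _ _ := h.c₂_b _ (by omega) (by omega)
  c₂_b i _ _ := h.c₁_b _ (by omega) (by omega)
  c₁_last := by simpa using h.c₂_first
  c₂_first := h.c₁_last
  centers := by
    simpa [eq_comm, G.adj_comm c₁ c₂, and_comm (a := G.Adj c₁ (b 0))] using h.centers

theorem s_ne_b (h : IsAW G s c₁ c₂ d b) {i : ℕ} (hi : i ≤ d + 1) : s ≠ b i := by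
  rintro rfl
  cases i with
  | zero => exact h.c₂_first h.s_c₂.symm
  | succ i => exact h.s_b i (by omega) (h.path.adj_succ hi).symm

theorem ne_b_of_adj (h : IsAW G s c₁ c₂ d b) (hx : G.Adj s x) {i : ℕ} (hi : i ≤ d + 1) :
    x ≠ b i := by
  rintro rfl
  exact h.s_b i hi hx

theorem c₁_b_iff_of_eq (h : IsAW G s c₁ c₁ d b) {i : ℕ} (hi : i ≤ d + 1) :
    G.Adj c₁ (b i) ↔ 1 ≤ i ∧ i ≤ d := by
  refine ⟨fun e => ⟨?_, ?_⟩, fun e => h.c₁_b i e.1 e.2⟩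
  · rw [Nat.one_le_iff_ne_zero]
    rintro rfl
    exact h.c₂_first e
  · by_contra hd
    exact h.c₁_last (show i = d + 1 by omega ▸ e)

theorem c₁_b_iff_of_ne (h : IsAW G s c₁ c₂ d b) (hne : c₁ ≠ c₂) {i : ℕ} (hi : i ≤ d + 1) :
    G.Adj c₁ (b i) ↔ i ≤ d := by
  refine ⟨fun e => ?_, fun hid => ?_⟩
  · by_contra hd
    exact h.c₁_last ((show i = d + 1 by omega) ▸ e)
  · rcases Nat.eq_zero_or_pos i with rfl | h1
    · exact (h.centers.resolve_left hne).2.1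
    · exact h.c₁_b i h1 hid

theorem c₂_b_iff_of_ne (h : IsAW G s c₁ c₂ d b) (hne : c₁ ≠ c₂) {i : ℕ} (hi : i ≤ d + 1) :
    G.Adj c₂ (b i) ↔ 1 ≤ i := by
  have := h.reverse.c₁_b_iff_of_ne hne.symm (i := d + 1 - i) (by omega)
  rw [Nat.sub_sub_self hi] at this
  rw [this]
  omega

/-- The placement of the vertices of the `†`-AW at `s`, `c` and `b 0, …, b (d + 1)`. -/
def dagMap (s c : V) (d : ℕ) (b : ℕ → V) : DagVertex d → V
  | .s => s
  | .c => c
  | .b i => b i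

/-- The placement of the vertices of the `‡`-AW at `s`, `c₁`, `c₂` and `b 0, …, b (d + 1)`. -/
def ddagMap (s c₁ c₂ : V) (d : ℕ) (b : ℕ → V) : DdagVertex d → V
  | .s => s
  | .c₁ => c₁
  | .c₂ => c₂
  | .b i => b i

theorem dagMap_injective (h : IsAW G s c₁ c₁ d b) : Function.Injective (dagMap s c₁ d b) := by
  have hs := fun i : Fin (d + 2) => h.s_ne_b (i := i) (by omega)
  have hc := fun i : Fin (d + 2) => h.ne_b_of_adj h.s_c₁ (i := i) (by omega)
  have hb := fun i j : Fin (d + 2) => h.path.injOn i (by omega) j (by omega)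
  have := h.s_c₁.ne
  rintro (_ | _ | i) (_ | _ | j) e <;> simp only [dagMap] at e <;> grind

theorem dagMap_adj_iff (h : IsAW G s c₁ c₁ d b) (v w : DagVertex d) :
    G.Adj (dagMap s c₁ d b v) (dagMap s c₁ d b w) ↔ (dagGraph d).Adj v w := by
  have hs := fun i : Fin (d + 2) => h.s_b i (by omega)
  have hc := fun i : Fin (d + 2) => h.c₁_b_iff_of_eq (i := i) (by omega)
  have hb : ∀ i j : Fin (d + 2), G.Adj (b i) (b j) ↔
      i ≠ j ∧ ((i : ℕ) + 1 = j ∨ (j : ℕ) + 1 = i) := fun i j => by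
    rw [h.path.adj_iff i (by omega) j (by omega), ne_eq, Fin.ext_iff]
    omega
  rcases v with _ | _ | i <;> rcases w with _ | _ | j <;>
    simp [dagMap, dagGraph, dagRel, h.s_c₁, h.s_c₁.symm, hs, hc, hb, G.adj_comm (b _) c₁,
      G.adj_comm (b _) s]

theorem ddagMap_injective (h : IsAW G s c₁ c₂ d b) (hne : c₁ ≠ c₂) :
    Function.Injective (ddagMap s c₁ c₂ d b) := by
  have hs := fun i : Fin (d + 2) => h.s_ne_b (i := i) (by omega)
  have hc₁ := fun i : Fin (d + 2) => h.ne_b_of_adj h.s_c₁ (i := i) (by omega)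
  have hc₂ := fun i : Fin (d + 2) => h.ne_b_of_adj h.s_c₂ (i := i) (by omega)
  have hb := fun i j : Fin (d + 2) => h.path.injOn i (by omega) j (by omega)
  have hsc₁ := h.s_c₁.ne
  have hsc₂ := h.s_c₂.ne
  rintro (_ | _ | _ | i) (_ | _ | _ | j) e <;> simp only [ddagMap] at e <;> grind

theorem ddagMap_adj_iff (h : IsAW G s c₁ c₂ d b) (hne : c₁ ≠ c₂) (v w : DdagVertex d) :
    G.Adj (ddagMap s c₁ c₂ d b v) (ddagMap s c₁ c₂ d b w) ↔ (ddagGraph d).Adj v w := by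
  have hs := fun i : Fin (d + 2) => h.s_b i (by omega)
  have hc₁ := fun i : Fin (d + 2) => h.c₁_b_iff_of_ne hne (i := i) (by omega)
  have hc₂ := fun i : Fin (d + 2) => h.c₂_b_iff_of_ne hne (i := i) (by omega)
  have hcc := (h.centers.resolve_left hne).1
  have hb : ∀ i j : Fin (d + 2), G.Adj (b i) (b j) ↔
      i ≠ j ∧ ((i : ℕ) + 1 = j ∨ (j : ℕ) + 1 = i) := fun i j => by
    rw [h.path.adj_iff i (by omega) j (by omega), ne_eq, Fin.ext_iff]
    omega
  rcases v with _ | _ | _ | i <;> rcases w with _ | _ | _ | j <;>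
    simp [ddagMap, ddagGraph, ddagRel, h.s_c₁, h.s_c₁.symm, h.s_c₂, h.s_c₂.symm, hcc, hcc.symm,
      hs, hc₁, hc₂, hb, G.adj_comm (b _) c₁, G.adj_comm (b _) c₂, G.adj_comm (b _) s]

/-- The embedding of the `†`-AW onto an AW with a single center. -/
def dagEmbedding (h : IsAW G s c₁ c₁ d b) : dagGraph d ↪g G :=
  ⟨⟨dagMap s c₁ d b, h.dagMap_injective⟩, h.dagMap_adj_iff _ _⟩

/-- The embedding of the `‡`-AW onto an AW with two centers. -/
def ddagEmbedding (h : IsAW G s c₁ c₂ d b) (hne : c₁ ≠ c₂) : ddagGraph d ↪g G :=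
  ⟨⟨ddagMap s c₁ c₂ d b, h.ddagMap_injective hne⟩, h.ddagMap_adj_iff hne _ _⟩

theorem exists_longAW (h : IsAW G s c₁ c₂ d b) (hd : 3 < d) :
    ∃ W : LongAW G, W.d = d ∧ W.shallowTerminal = s ∧ W.c₁ = c₁ ∧ W.c₂ = c₂ ∧
      ∀ i, W.path i = b i := by
  by_cases hne : c₁ = c₂
  · subst hne
    exact ⟨.dag d hd h.dagEmbedding, rfl, rfl, rfl, rfl, fun _ => rfl⟩
  · exact ⟨.ddag d hd (h.ddagEmbedding hne), rfl, rfl, rfl, rfl, fun _ => rfl⟩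

theorem three_lt_of_isReduced (h : IsAW G s c₁ c₂ d b) (hG : IsReduced G)
    (hd : 2 ≤ d ∨ 1 ≤ d ∧ c₁ ≠ c₂) : 3 < d := by
  by_contra! hd3
  by_cases hne : c₁ = c₂
  · subst hne
    exact hG.2 (.inr (.inr (.inl ⟨d, by simpa using hd, hd3, ⟨h.dagEmbedding⟩⟩)))
  · exact hG.2 (.inr (.inr (.inr ⟨d, by omega, hd3, ⟨h.ddagEmbedding hne⟩⟩)))

end IsAW

/-- A triangle with a pendant vertex at each corner is the `†`-AW with two base vertices. -/
theorem HasSmallAW.of_net {V : Type*} {G : SimpleGraph V} (a₀ a₁ a₂ b₀ b₁ b₂ : V)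
    (hadj : G.Adj a₀ a₁ ∧ G.Adj a₁ a₂ ∧ G.Adj a₀ a₂ ∧ G.Adj a₀ b₀ ∧ G.Adj a₁ b₁ ∧ G.Adj a₂ b₂)
    (hnot : ¬ G.Adj a₀ b₁ ∧ ¬ G.Adj a₀ b₂ ∧ ¬ G.Adj a₁ b₀ ∧ ¬ G.Adj a₁ b₂ ∧ ¬ G.Adj a₂ b₀ ∧
      ¬ G.Adj a₂ b₁ ∧ ¬ G.Adj b₀ b₁ ∧ ¬ G.Adj b₀ b₂ ∧ ¬ G.Adj b₁ b₂) : HasSmallAW G := by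
  let b : ℕ → V := fun | 0 => b₁ | 1 => a₁ | 2 => a₂ | _ => b₂
  have hAW : IsAW G b₀ a₀ a₀ 2 b := by
    refine ⟨⟨?_, ?_⟩, ?_, ?_, ?_, ?_, ?_, ?_, ?_, .inl rfl⟩ <;> grind [G.adj_comm, G.irrefl]
  exact .inr (.inr (.inl ⟨2, le_rfl, by omega, ⟨hAW.dagEmbedding⟩⟩))

namespace LongAW

variable {V : Type*} {G : SimpleGraph V}

theorem three_lt_d : ∀ W : LongAW G, 3 < W.d
  | .dag _ hd _ => hd
  | .ddag _ hd _ => hd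

/-- The path of `W`, indexed by natural numbers.  (Indices beyond `W.d + 1` are reduced modulo
`W.d + 2`.) -/
def natPath (W : LongAW G) (i : ℕ) : V := W.path (Fin.ofNat _ i)

@[simp] theorem natPath_val (W : LongAW G) (i : Fin (W.d + 2)) : W.natPath i = W.path i :=
  congrArg W.path (Fin.ofNat_val_eq_self i)

theorem isAW : ∀ W : LongAW G, IsAW G W.shallowTerminal W.c₁ W.c₂ W.d W.natPath
  | .dag d _ f => (isAW_dagGraph d).map f
  | .ddag d _ f => (isAW_ddagGraph d).map f

end LongAW

namespace IsAW

variable {V : Type*} {G : SimpleGraph V} {s c c₁ c₂ x : V} {d : ℕ} {b : ℕ → V}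

/-- Otherwise `x s c (b i)` is a hole. -/
theorem not_adj_b_of_not_adj (h : IsAW G s c₁ c₂ d b) (hG : ¬ HasHole G) (hx : G.Adj s x)
    (hc : G.Adj s c) (hxc : ¬ G.Adj x c) (hne : x ≠ c) {i : ℕ} (hi : i ≤ d + 1)
    (hcb : G.Adj c (b i)) : ¬ G.Adj x (b i) := fun e =>
  hG (HasHole.of_square hx.symm hc hcb e.symm hxc (h.s_b i hi) hne (h.s_ne_b hi))

/-- Otherwise `x (b 0) (b 1) c₂ s` is a hole. -/
theorem not_adj_first_of_not_adj (h : IsAW G s c₁ c₂ d b) (hG : ¬ HasHole G) (hd : 1 ≤ d)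
    (hx : G.Adj s x) (hxc : ¬ G.Adj x c₂) (hx1 : ¬ G.Adj x (b 1)) : ¬ G.Adj x (b 0) := fun e =>
  hG (HasHole.of_pentagon e (h.path.adj_succ (by omega)) (h.c₂_b 1 le_rfl hd).symm h.s_c₂.symm hx
    hx1 (fun e => h.c₂_first e.symm) (fun e => h.s_b 1 (by omega) e.symm) (fun e => hxc e.symm)
    (h.s_b 0 (by omega)))

theorem adj_center (h : IsAW G s c c d b) (hG : IsReduced G) (hd : 3 ≤ d)
    (hx : G.Adj s x) (hne : x ≠ c) : G.Adj x c := by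
  by_contra hn
  have hb : ∀ i, 1 ≤ i → i ≤ d → ¬ G.Adj x (b i) := fun i h1 hi =>
    h.not_adj_b_of_not_adj hG.1 hx h.s_c₁ hn hne (by omega) (h.c₁_b i h1 hi)
  have hx0 : ¬ G.Adj x (b 0) :=
    h.not_adj_first_of_not_adj hG.1 (by omega) hx hn (hb 1 le_rfl (by omega))
  have hxd : ¬ G.Adj x (b (d + 1)) := h.reverse.not_adj_first_of_not_adj hG.1 (by omega) hx hn
    (by simpa using hb d (by omega) le_rfl)
  refine hG.2 (HasSmallAW.of_longClaw c s x (b 1) (b 0) (b d) (b (d + 1)) ?_ ?_) <;>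
    grind [IsAW, IsInducedPath, G.adj_comm]

theorem adj_center_or (h : IsAW G s c₁ c₂ d b) (hG : IsReduced G) (hd : 1 ≤ d)
    (hcc : c₁ ≠ c₂) (hx : G.Adj s x) (h₁ : x ≠ c₁) (h₂ : x ≠ c₂) : G.Adj x c₁ ∨ G.Adj x c₂ := by
  by_contra! hn
  obtain ⟨hc, hc0, hcd⟩ := h.centers.resolve_left hcc
  have hx0 := h.not_adj_b_of_not_adj hG.1 hx h.s_c₁ hn.1 h₁ (by omega) hc0
  have hxd := h.not_adj_b_of_not_adj hG.1 hx h.s_c₂ hn.2 h₂ (by omega) hcd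
  refine hG.2 (HasSmallAW.of_net s c₁ c₂ x (b 0) (b (d + 1)) ?_ ?_) <;>
    grind [IsAW, IsInducedPath, G.adj_comm]

theorem adj_right_of_adj_left (h : IsAW G s c₁ c₂ d b) (hG : IsReduced G) (hd : 2 ≤ d)
    (hcc : c₁ ≠ c₂) (hx : G.Adj s x) (h₁ : G.Adj x c₁) (h₂ : x ≠ c₂) : G.Adj x c₂ := by
  by_contra hn
  obtain ⟨hc, hc0, hcd⟩ := h.centers.resolve_left hcc
  have hx1 : ¬ G.Adj x (b 1) :=
    h.not_adj_b_of_not_adj hG.1 hx h.s_c₂ hn h₂ (by omega) (h.c₂_b 1 le_rfl (by omega))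
  have hxd := h.not_adj_b_of_not_adj hG.1 hx h.s_c₂ hn h₂ (by omega) hcd
  have hx0 := h.not_adj_first_of_not_adj hG.1 (by omega) hx hn hx1
  refine hG.2 (HasSmallAW.of_whippingTop x s c₂ (b 1) (b 0) c₁ (b (d + 1)) ?_ ?_) <;>
    grind [IsAW, IsInducedPath, G.adj_comm]

theorem adj_centers (h : IsAW G s c₁ c₂ d b) (hG : IsReduced G) (hd : 3 ≤ d)
    (hx : G.Adj s x) (h₁ : x ≠ c₁) (h₂ : x ≠ c₂) : G.Adj x c₁ ∧ G.Adj x c₂ := by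
  by_cases hcc : c₁ = c₂
  · subst hcc
    exact (and_self_iff).2 (h.adj_center hG hd hx h₁)
  rcases h.adj_center_or hG (by omega) hcc hx h₁ h₂ with e | e
  · exact ⟨e, h.adj_right_of_adj_left hG (by omega) hcc hx e h₂⟩
  · exact ⟨h.reverse.adj_right_of_adj_left hG (by omega) (Ne.symm hcc) hx e h₁, e⟩

theorem replace_shallowTerminal (h : IsAW G s c₁ c₂ d b) (h₁ : G.Adj x c₁) (h₂ : G.Adj x c₂)
    (hx : ∀ i ≤ d + 1, ¬ G.Adj x (b i)) : IsAW G x c₁ c₂ d b :=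
  { h with s_c₁ := h₁, s_c₂ := h₂, s_b := hx }

section Interval

variable {p q : ℕ} (h : IsAW G s c₁ c₂ d b) (hx : G.Adj s x)
  (hpq : ∀ i ≤ d + 1, (G.Adj x (b i) ↔ p ≤ i ∧ i ≤ q))

include h hx hpq

theorem isAW_initial (h₂ : G.Adj x c₂) (hp : p = 0) (hq : 1 ≤ q) (hqd : q < d) :
    IsAW G s x c₂ q b where
  path := by simpa using h.path.segment (p := 0) (l := q + 1) (by omega)
  s_c₁ := hx
  s_c₂ := h.s_c₂
  s_b i hi := h.s_b i (by omega)
  c₁_b i _ hi := (hpq i (by omega)).2 ⟨by omega, hi⟩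
  c₂_b i h1 hi := h.c₂_b i h1 (by omega)
  c₁_last := by simp [hpq (q + 1) (by omega)]
  c₂_first := h.c₂_first
  centers := Or.inr ⟨h₂, by simp [hpq, hp], h.c₂_b _ (by omega) (by omega)⟩

theorem isAW_inner (hp : 0 < p) (hpq' : p < q) (hqd : q < d) :
    IsAW G s x x (q - p + 1) (fun i => b (p - 1 + i)) := by
  have hseg : ∀ i ≤ q - p + 2, G.Adj x (b (p - 1 + i)) ↔ 1 ≤ i ∧ i ≤ q - p + 1 := fun i hi => by
    rw [hpq _ (by omega)]
    omega
  exact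
    { path := h.path.segment (by omega)
      s_c₁ := hx
      s_c₂ := hx
      s_b := fun i hi => h.s_b _ (by omega)
      c₁_b := fun i h1 hi => (hseg i (by omega)).2 ⟨h1, hi⟩
      c₂_b := fun i h1 hi => (hseg i (by omega)).2 ⟨h1, hi⟩
      c₁_last := (hseg _ le_rfl).not.2 (by omega)
      c₂_first := (hseg 0 (by omega)).not.2 (by omega)
      centers := Or.inl rfl }

theorem lt_of_interval (hG : IsReduced G) (hd : 3 ≤ d) (h₂ : G.Adj x c₂) (hle : p ≤ q)
    (hqd : q < d) : p < q := by
  by_contra! hqp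
  obtain rfl : p = q := hle.antisymm hqp
  have hne := h.ne_b_of_adj hx (i := 1) (by omega)
  have hne₂ := h.ne_b_of_adj h.s_c₂ (i := 0) (by omega)
  rcases p with _ | _ | p
  · refine hG.1 (HasHole.of_square (a₀ := x) (a₁ := b 0) (a₂ := b 1) (a₃ := c₂)
      ?_ ?_ ?_ ?_ ?_ ?_ ?_ ?_) <;> grind [IsAW, IsInducedPath, G.adj_comm]
  · refine hG.2 (HasSmallAW.of_whippingTop s x (b 1) (b 2) (b 3) c₂ (b 0) ?_ ?_) <;>
      grind [IsAW, IsInducedPath, G.adj_comm]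
  · refine hG.2 (HasSmallAW.of_longClaw (b (p + 2)) x s (b (p + 1)) (b p) (b (p + 3)) (b (p + 4))
      ?_ ?_) <;> grind [IsAW, IsInducedPath, G.adj_comm]

end Interval

theorem exists_shorter (h : IsAW G s c₁ c₂ d b) (hG : IsReduced G) (hd : 3 ≤ d)
    (hx : G.Adj s x) (h₂ : G.Adj x c₂) {p q : ℕ} (hle : p ≤ q) (hqd : q < d)
    (hpq : ∀ i ≤ d + 1, (G.Adj x (b i) ↔ p ≤ i ∧ i ≤ q)) :
    ∃ W : LongAW G, W.shallowTerminal = s ∧ W.d < d := by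
  have hlt := h.lt_of_interval hx hpq hG hd h₂ hle hqd
  rcases Nat.eq_zero_or_pos p with hp | hp
  · have hAW := h.isAW_initial hx hpq h₂ hp (by omega) hqd
    obtain ⟨W, hWd, hWs, -⟩ :=
      hAW.exists_longAW (hAW.three_lt_of_isReduced hG (.inr ⟨by omega, h₂.ne⟩))
    exact ⟨W, hWs, by omega⟩
  · have hAW := h.isAW_inner hx hpq hp hlt hqd
    obtain ⟨W, hWd, hWs, -⟩ :=
      hAW.exists_longAW (hAW.three_lt_of_isReduced hG (.inl (by omega)))
    exact ⟨W, hWs, by omega⟩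

theorem not_adj_ends (h : IsAW G s c c d b) (hG : IsReduced G) (hd : 3 ≤ d) {a : V}
    (hca : G.Adj c a) (hsa : ¬ G.Adj s a) (h0 : G.Adj a (b 0)) : ¬ G.Adj a (b (d + 1)) := by
  intro hlast
  have hne : ∀ i ≤ d + 1, a ≠ b i := by
    rintro i hi rfl
    have := (h.path.adj_iff i hi 0 (by omega)).1 h0
    have := (h.path.adj_iff i hi _ le_rfl).1 hlast
    omega
  have hab : ∀ i ≤ d + 1, G.Adj a (b i) := fun i hi =>
    h.path.adj_of_adj_of_adj hG.1 hne (Nat.zero_le i) hi le_rfl h0 hlast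
  refine hG.2 (HasSmallAW.of_whippingTop (b 0) (b 1) c (b d) (b (d + 1)) a s ?_ ?_) <;>
    grind [IsAW, IsInducedPath, G.adj_comm]

end IsAW

namespace LongAW

variable {V : Type*} {G : SimpleGraph V} {s x : V}

/-- `W` has the fewest base vertices among the long AWs of `G` with the same shallow terminal. -/
def IsShortest (W : LongAW G) : Prop :=
  ∀ W' : LongAW G, W'.shallowTerminal = W.shallowTerminal → W.d ≤ W'.d

theorem exists_isShortest (hs : s ∈ ST G) :
    ∃ W : LongAW G, W.shallowTerminal = s ∧ W.IsShortest := by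
  obtain ⟨W, hWs, hmin⟩ := WellFounded.has_min (measure (d (G := G))).wf
    {W | W.shallowTerminal = s} hs
  exact ⟨W, hWs, fun W' hW' => not_lt.1 (hmin W' (hW'.trans hWs))⟩

theorem exists_adj_natPath (W : LongAW G) (hxST : x ∉ ST G)
    (h₁ : G.Adj x W.c₁) (h₂ : G.Adj x W.c₂) : ∃ i ≤ W.d + 1, G.Adj x (W.natPath i) := by
  by_contra! hno
  obtain ⟨W', -, hW's, -⟩ :=
    (W.isAW.replace_shallowTerminal h₁ h₂ hno).exists_longAW W.three_lt_d
  exact hxST ⟨W', hW's⟩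

/-- The neighbors of `x` on the path form an interval; if it misses a base vertex, then it leaves
room on one side for a shorter AW. -/
theorem IsShortest.adj_natPath {W : LongAW G} (hW : W.IsShortest) (hG : IsReduced G)
    (hx : G.Adj W.shallowTerminal x) (hxST : x ∉ ST G) {i : ℕ} (h1 : 1 ≤ i) (hi : i ≤ W.d) :
    G.Adj x (W.natPath i) := by
  by_cases e₁ : x = W.c₁
  · exact e₁ ▸ W.isAW.c₁_b i h1 hi
  by_cases e₂ : x = W.c₂
  · exact e₂ ▸ W.isAW.c₂_b i h1 hi
  obtain ⟨h₁, h₂⟩ := W.isAW.adj_centers hG W.three_lt_d.le hx e₁ e₂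
  obtain ⟨p, q, hle, hq, hpq⟩ := W.isAW.path.exists_interval hG.1
    (fun i => W.isAW.ne_b_of_adj hx) (W.exists_adj_natPath hxST h₁ h₂)
  have hq : W.d ≤ q := by
    by_contra! hlt
    obtain ⟨W', hs, hlt⟩ := W.isAW.exists_shorter hG W.three_lt_d.le hx h₂ hle hlt hpq
    exact hlt.not_ge (hW W' hs)
  have hp : p ≤ 1 := by
    by_contra! hlt
    obtain ⟨W', hs, hlt⟩ := W.isAW.reverse.exists_shorter hG W.three_lt_d.le hx h₁
      (p := W.d + 1 - q) (q := W.d + 1 - p) (by omega) (by omega)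
      fun j hj => (hpq _ (by omega)).trans (by omega)
    exact hlt.not_ge (hW W' hs)
  exact (hpq i (by omega)).2 ⟨by omega, by omega⟩

theorem IsShortest.isGoodAW {W : LongAW G} (hW : W.IsShortest) (hG : IsReduced G) :
    IsGoodAW G W.shallowTerminal W := by
  refine ⟨rfl, ?_⟩
  rintro _ ⟨i, h1, hi, rfl⟩ x ⟨hx, hxST⟩
  exact W.natPath_val i ▸ (hW.adj_natPath hG hx hxST h1 hi).symm

end LongAW

theorem exists_isGoodAW {V : Type*} {G : SimpleGraph V} (hG : IsReduced G) {s : V}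
    (hs : s ∈ ST G) : ∃ W : LongAW G, IsGoodAW G s W := by
  obtain ⟨W, rfl, hW⟩ := LongAW.exists_isShortest hs
  exact ⟨W, hW.isGoodAW hG⟩

/-! ### Counting loops on the machine -/

namespace State

variable (σ : State) (x a i v : ℕ)

/-- The state `σ` with `v` in register `x`. -/
def setReg : State := ⟨Function.update σ.reg x v, σ.arr⟩

/-- The state `σ` with `v` in cell `i` of array `a`. -/
def setCell : State := ⟨σ.reg, Function.update σ.arr a (Function.update (σ.arr a) i v)⟩

@[simp] theorem setReg_reg : (σ.setReg x v).reg = Function.update σ.reg x v := rfl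

@[simp] theorem setReg_arr : (σ.setReg x v).arr = σ.arr := rfl

@[simp] theorem setCell_reg : (σ.setCell a i v).reg = σ.reg := rfl

@[simp] theorem setCell_arr :
    (σ.setCell a i v).arr = Function.update σ.arr a (Function.update (σ.arr a) i v) := rfl

/-- The state before round `i` of a loop with counter `x` and body `f`, entered in state `σ`. -/
def rounds (f : State → State) : ℕ → State
  | 0 => σ.setReg x 0
  | i + 1 => (f (rounds f i)).setReg x (i + 1)

theorem rounds_reg_counter (f : State → State) : (σ.rounds x f i).reg x = i := by
  cases i <;> simp [rounds]

/-- `τ` arises from `σ` by changing only registers in `rs` and arrays in `as`. -/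
structure Agree (rs as : List ℕ) (σ τ : State) : Prop where
  reg : ∀ x ∉ rs, τ.reg x = σ.reg x
  arr : ∀ a ∉ as, τ.arr a = σ.arr a

namespace Agree

variable {σ} {τ ρ : State} {rs rs' as as' : List ℕ}

theorem refl : Agree rs as σ σ := ⟨fun _ _ => rfl, fun _ _ => rfl⟩

theorem trans (h : Agree rs as σ τ) (h' : Agree rs as τ ρ) : Agree rs as σ ρ :=
  ⟨fun x hx => (h'.reg x hx).trans (h.reg x hx), fun a ha => (h'.arr a ha).trans (h.arr a ha)⟩

theorem mono (h : Agree rs as σ τ) (hr : rs ⊆ rs') (ha : as ⊆ as') : Agree rs' as' σ τ :=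
  ⟨fun x hx => h.reg x (mt (@hr x) hx), fun a hx => h.arr a (mt (@ha a) hx)⟩

theorem setReg : Agree [x] [] σ (σ.setReg x v) :=
  ⟨fun y hy => by simp_all, fun _ _ => rfl⟩

theorem setCell : Agree [] [a] σ (σ.setCell a i v) :=
  ⟨fun _ _ => rfl, fun b hb => by simp_all⟩

theorem rounds {f : State → State} (hf : ∀ τ, Agree rs as τ (f τ)) :
    Agree (x :: rs) as σ (σ.rounds x f i) := by
  induction i with
  | zero => exact (setReg x 0).mono (by simp) (by simp)
  | succ i ih => exact ih.trans (((hf _).mono (by simp) (by simp)).trans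
      ((setReg x (i + 1)).mono (by simp) (by simp)))

end Agree

end State

open State (Agree)

namespace Expr

variable (e f : Expr) (σ : State)

/-- The conjunction of two tests. -/
def and : Expr := .eq (.add (.eq e (.const 0)) (.eq f (.const 0))) (.const 0)

/-- The disjunction of two tests. -/
def or : Expr := .add e f

/-- The negation of a test. -/
def not : Expr := .eq e (.const 0)

/-- The test `e` succeeds: `e` is nonzero in the state `σ`. -/
def Holds : Prop := e.eval σ ≠ 0

instance : Decidable (e.Holds σ) := inferInstanceAs (Decidable (_ ≠ _))

variable {e f σ}

@[simp] theorem holds_lt : (Expr.lt e f).Holds σ ↔ e.eval σ < f.eval σ := by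
  simp [Holds, eval]

@[simp] theorem holds_eq : (Expr.eq e f).Holds σ ↔ e.eval σ = f.eval σ := by
  simp [Holds, eval]

@[simp] theorem holds_not : e.not.Holds σ ↔ ¬ e.Holds σ := by
  by_cases h : e.eval σ = 0 <;> simp [Holds, not, eval, h]

@[simp] theorem holds_or : (e.or f).Holds σ ↔ e.Holds σ ∨ f.Holds σ := by
  simp only [Holds, or, eval]
  omega

@[simp] theorem holds_and : (e.and f).Holds σ ↔ e.Holds σ ∧ f.Holds σ := by
  by_cases he : e.eval σ = 0 <;> by_cases hf : f.eval σ = 0 <;> simp [Holds, and, eval, he, hf]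

end Expr

/-- Programs whose loops run a register through `0, …, n - 1`, where `n` is the content of
register `0`. -/
inductive ForProg : Type
  | assign (x : ℕ) (e : Expr) : ForProg
  | write (a : ℕ) (i e : Expr) : ForProg
  | seq (P Q : ForProg) : ForProg
  | when (e : Expr) (P : ForProg) : ForProg
  | forLoop (x : ℕ) (P : ForProg) : ForProg

namespace ForProg

/-- The translation into the machine language. -/
def compile : ForProg → Prog
  | assign x e => .assign x e
  | write a i e => .write a i e
  | seq P Q => .seq P.compile Q.compile
  | when e P => .branch e P.compile .skip
  | forLoop x P => .seq (.assign x (.const 0)) (.loop (.lt (.reg x) (.reg 0))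
      (.seq P.compile (.assign x (.add (.reg x) (.const 1)))))

/-- The final state. -/
def run : ForProg → State → State
  | assign x e, σ => σ.setReg x (e.eval σ)
  | write a i e, σ => σ.setCell a (i.eval σ) (e.eval σ)
  | seq P Q, σ => Q.run (P.run σ)
  | when e P, σ => if e.Holds σ then P.run σ else σ
  | forLoop x P, σ => σ.rounds x P.run (σ.reg 0)

/-- The registers that the program may change. -/
def regs : ForProg → List ℕ
  | assign x _ => [x]
  | write _ _ _ => []
  | seq P Q => P.regs ++ Q.regs
  | when _ P => P.regs
  | forLoop x P => x :: P.regs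

/-- The arrays that the program may change. -/
def arrs : ForProg → List ℕ
  | assign _ _ => []
  | write a _ _ => [a]
  | seq P Q => P.arrs ++ Q.arrs
  | when _ P => P.arrs
  | forLoop _ P => P.arrs

/-- No loop changes its own counter in its body. -/
def Wf : ForProg → Prop
  | assign _ _ => True
  | write _ _ _ => True
  | seq P Q => P.Wf ∧ Q.Wf
  | when _ P => P.Wf
  | forLoop x P => P.Wf ∧ x ∉ P.regs

open Polynomial in
/-- A bound for the number of steps, in terms of the content of register `0`. -/
noncomputable def time : ForProg → ℕ[X]
  | assign _ e => C (e.cost + 1)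
  | write _ i e => C (i.cost + e.cost + 1)
  | seq P Q => P.time + Q.time
  | when e P => C (e.cost + 2) + P.time
  | forLoop _ P => C 6 + X * (P.time + C 8)

theorem run_agree (P : ForProg) (σ : State) : Agree P.regs P.arrs σ (P.run σ) := by
  induction P generalizing σ with
  | assign x e => exact .setReg _ _
  | write a i e => exact .setCell _ _ _
  | seq P Q hP hQ =>
    exact ((hP σ).mono (by simp [regs]) (by simp [arrs])).trans
      ((hQ _).mono (by simp [regs]) (by simp [arrs]))
  | when e P hP =>
    rw [run]
    split_ifs
    exacts [hP σ, .refl]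
  | forLoop x P hP => exact .rounds _ _ hP

theorem exec_rounds {x n T : ℕ} {P : ForProg} (hx : x ∉ P.regs) (h0 : 0 ∉ x :: P.regs)
    (hP : ∀ σ : State, σ.reg 0 = n → ∃ t ≤ T, Exec P.compile σ t (P.run σ))
    {σ : State} (hσ : σ.reg 0 = n) {i k : ℕ} (hik : i + k = n) :
    ∃ t ≤ 4 + k * (T + 8), Exec (.loop (.lt (.reg x) (.reg 0))
      (.seq P.compile (.assign x (.add (.reg x) (.const 1))))) (σ.rounds x P.run i) t
      (σ.rounds x P.run n) := by
  have hcounter (i) : (σ.rounds x P.run i).reg x = i := σ.rounds_reg_counter x i P.run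
  have hsize (i) : (σ.rounds x P.run i).reg 0 = n :=
    ((Agree.rounds x i P.run_agree).reg 0 h0).trans hσ
  induction k generalizing i with
  | zero =>
    obtain rfl : i = n := hik
    exact ⟨_, by simp [Expr.cost], .loop_done (by simp [Expr.eval, hsize, hcounter])⟩
  | succ k ih =>
    obtain ⟨t, ht, hbody⟩ := hP _ (hsize i)
    have hinc := Exec.assign (P.run (σ.rounds x P.run i)) x (.add (.reg x) (.const 1))
    rw [show Expr.eval _ (.add (.reg x) (.const 1)) = i + 1 by
      simp [Expr.eval, (P.run_agree _).reg x hx, hcounter]] at hinc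
    obtain ⟨u, hu, hloop⟩ := ih (i := i + 1) (by omega)
    have htest : (Expr.lt (.reg x) (.reg 0)).Holds (σ.rounds x P.run i) := by
      simp only [Expr.holds_lt, Expr.eval, hsize, hcounter]
      omega
    refine ⟨_, ?_, .loop_step htest (.seq hbody hinc) hloop⟩
    simp only [Expr.cost]
    linarith

theorem exec_compile (P : ForProg) (hP : P.Wf) (h0 : 0 ∉ P.regs) (σ : State) :
    ∃ t ≤ P.time.eval (σ.reg 0), Exec P.compile σ t (P.run σ) := by
  induction P generalizing σ with
  | assign x e => exact ⟨_, by simp [time], .assign σ x e⟩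
  | write a i e => exact ⟨_, by simp [time], .write σ a i e⟩
  | seq P Q ihP ihQ =>
    simp only [regs, List.mem_append, not_or] at h0
    obtain ⟨t, ht, h⟩ := ihP hP.1 h0.1 σ
    obtain ⟨u, hu, h'⟩ := ihQ hP.2 h0.2 (P.run σ)
    rw [(run_agree P σ).reg 0 h0.1] at hu
    exact ⟨_, by simp only [time, Polynomial.eval_add]; omega, .seq h h'⟩
  | when e P ih =>
    obtain ⟨t, ht, h⟩ := ih hP h0 σ
    by_cases he : e.Holds σ
    · rw [run, if_pos he]
      exact ⟨_, by simp [time]; omega, .branch_true he h⟩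
    · rw [run, if_neg he]
      exact ⟨_, by simp [time]; omega, .branch_false (not_not.1 he) (.skip σ)⟩
  | forLoop x P ih =>
    have h0P : 0 ∉ P.regs := fun h => h0 (List.mem_cons_of_mem _ h)
    obtain ⟨t, ht, h⟩ := exec_rounds hP.2 h0 (fun τ hτ => hτ ▸ ih hP.1 h0P τ) rfl
      (zero_add (σ.reg 0))
    refine ⟨_, ?_, .seq (.assign σ x (.const 0)) h⟩
    simp [time, Expr.cost]
    omega

/-- Nested loops with body `P`, the first counter in `xs` being that of the outermost loop. -/
def forLoops (xs : List ℕ) (P : ForProg) : ForProg := xs.foldr forLoop P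

section Rules

variable {x n : ℕ} {xs : List ℕ} {P : ForProg} {σ : State}

theorem forLoop_induction (I : ℕ → State → Prop) (hn : σ.reg 0 = n) (h0 : I 0 (σ.setReg x 0))
    (hstep : ∀ i < n, ∀ τ, τ.reg x = i → I i τ → I (i + 1) ((P.run τ).setReg x (i + 1))) :
    I n ((forLoop x P).run σ) := by
  suffices ∀ i ≤ n, I i (σ.rounds x P.run i) by simpa only [run, hn] using this n le_rfl
  intro i hi
  induction i with
  | zero => exact h0
  | succ i ih => exact hstep i hi _ (σ.rounds_reg_counter x i P.run) (ih (by omega))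

/-- `I` is kept by the counters `xs`, and by the body `P` as long as their values are below the
size `n` of the loops. -/
structure IsLoopInvariant (n : ℕ) (xs : List ℕ) (P : ForProg) (I : State → Prop) : Prop where
  size : ∀ τ, I τ → τ.reg 0 = n
  setReg : ∀ x ∈ xs, ∀ v τ, I τ → I (τ.setReg x v)
  run : ∀ τ, I τ → (∀ x ∈ xs, τ.reg x < n) → I (P.run τ)

variable {I Q : State → Prop}

theorem IsLoopInvariant.of_cons (h : IsLoopInvariant n (x :: xs) P I) (hxs : x ∉ xs)
    (hP : x ∉ P.regs) {i : ℕ} (hi : i < n) :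
    IsLoopInvariant n xs P (fun τ => I τ ∧ τ.reg x = i) where
  size τ hτ := h.size τ hτ.1
  setReg y hy v τ hτ := by
    have hxy : x ≠ y := fun e => hxs (e ▸ hy)
    exact ⟨h.setReg y (.tail x hy) v τ hτ.1, by simpa [hxy] using hτ.2⟩
  run τ hτ hlt :=
    ⟨h.run τ hτ.1 (List.forall_mem_cons.2 ⟨hτ.2 ▸ hi, hlt⟩), ((P.run_agree τ).reg x hP).trans hτ.2⟩

theorem IsLoopInvariant.forLoops (h : IsLoopInvariant n xs P I) (hxs : xs.Nodup)
    (hP : xs.Disjoint P.regs) (hσ : I σ) : I ((forLoops xs P).run σ) := by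
  induction xs generalizing I σ with
  | nil => exact h.run σ hσ (by simp)
  | cons x xs ih =>
    rw [List.nodup_cons] at hxs
    rw [List.disjoint_cons_left] at hP
    have hset := h.setReg x List.mem_cons_self
    exact forLoop_induction (fun _ => I) (h.size σ hσ) (hset _ _ hσ) fun i hi τ hx hτ =>
      hset _ _ (ih (h.of_cons hxs.1 hP.1 hi) hxs.2 hP.2 ⟨hτ, hx⟩).1

/-- What the body achieves when the counters take the values `ν`, and never undoes, holds in the
end. -/
theorem IsLoopInvariant.forLoops_visit (h : IsLoopInvariant n xs P I)
    (hQ : IsLoopInvariant n xs P (fun τ => I τ ∧ Q τ)) (hxs : xs.Nodup) (hP : xs.Disjoint P.regs)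
    (ν : ℕ → ℕ) (hν : ∀ x ∈ xs, ν x < n)
    (hvisit : ∀ τ, I τ → (∀ x ∈ xs, τ.reg x = ν x) → Q (P.run τ)) (hσ : I σ) :
    Q ((ForProg.forLoops xs P).run σ) := by
  induction xs generalizing I σ with
  | nil => exact hvisit σ hσ (by simp)
  | cons x xs ih =>
    rw [List.nodup_cons] at hxs
    rw [List.disjoint_cons_left] at hP
    rw [List.forall_mem_cons] at hν
    refine (forLoop_induction (fun i τ => I τ ∧ (ν x < i → Q τ)) (h.size σ hσ)
      ⟨h.setReg x (by simp) _ _ hσ, by simp⟩ fun i hi τ hx hτ => ?_).2 hν.1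
    have hI := ((h.of_cons hxs.1 hP.1 hi).forLoops hxs.2 hP.2 ⟨hτ.1, hx⟩).1
    refine ⟨h.setReg x (by simp) _ _ hI, fun hlt => (hQ.setReg x (by simp) _ _ ⟨hI, ?_⟩).2⟩
    rcases Nat.lt_succ_iff_lt_or_eq.1 hlt with hlt | rfl
    · exact ((hQ.of_cons hxs.1 hP.1 hi).forLoops hxs.2 hP.2 ⟨⟨hτ.1, hτ.2 hlt⟩, hx⟩).1.2
    · refine ih (h.of_cons hxs.1 hP.1 hi) ?_ hxs.2 hP.2 hν.2
        (fun ρ hρ hv => hvisit ρ hρ.1 (List.forall_mem_cons.2 ⟨hρ.2, hv⟩)) ⟨hτ.1, hx⟩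
      simpa only [and_right_comm] using hQ.of_cons hxs.1 hP.1 hi

end Rules

end ForProg

/-! ### Shortest paths between base terminals -/

/-- A breadth-first tree with root `w`, explored up to depth `k`.  The children are vertices in `B`,
`next` is the parent, `D` is the depth, and `D v = N` stands for a vertex `v` outside the tree. -/
structure IsBFSTree {V : Type*} (G : SimpleGraph V) (B : V → Prop) (w : V) (N k : ℕ) (D : V → ℕ)
    (next : V → V) : Prop where
  eq_zero_iff (v : V) : D v = 0 ↔ v = w
  le_or_eq (v : V) : D v ≤ k + 1 ∨ D v = N
  next_spec (v : V) : D v ≠ 0 → D v < N → B v ∧ G.Adj v (next v) ∧ D (next v) + 1 = D v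
  le_succ (v v' : V) : B v → G.Adj v v' → D v' < k → D v ≤ D v' + 1

namespace IsBFSTree

variable {V : Type*} {G : SimpleGraph V} {B : V → Prop} {u v v' w : V} {N k : ℕ} {D : V → ℕ}
  {next : V → V}

theorem root [DecidableEq V] (hN : 0 < N) :
    IsBFSTree G B w N 0 (Function.update (fun _ => N) w 0) id where
  eq_zero_iff v := by grind
  le_or_eq v := by grind
  next_spec v := by grind
  le_succ v v' _ _ h := absurd h (Nat.not_lt_zero _)

theorem insert [DecidableEq V] (h : IsBFSTree G B w N k D next) (hv : B v) (hadj : G.Adj v v')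
    (hk : D v' = k) (hN : D v = N) (hkN : k < N) :
    IsBFSTree G B w N k (Function.update D v (k + 1)) (Function.update next v v') where
  eq_zero_iff x := by grind [h.eq_zero_iff x]
  le_or_eq x := by grind [h.le_or_eq x]
  next_spec x := by grind [h.next_spec x]
  le_succ x x' := by
    have := h.le_succ x x'
    simp only [Function.update_apply]
    grind

theorem succ (h : IsBFSTree G B w N k D next)
    (hk : ∀ v v', B v → G.Adj v v' → D v' = k → D v ≤ k + 1) :
    IsBFSTree G B w N (k + 1) D next where
  eq_zero_iff := h.eq_zero_iff
  le_or_eq v := (h.le_or_eq v).imp_left (by omega)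
  next_spec := h.next_spec
  le_succ v v' hv hadj hlt := by
    rcases Nat.lt_succ_iff_lt_or_eq.1 hlt with hlt | heq
    · exact h.le_succ v v' hv hadj hlt
    · exact heq ▸ hk v v' hv hadj heq

theorem depth_iterate (h : IsBFSTree G B w N k D next) (hu : D u < N) {i : ℕ} (hi : i ≤ D u) :
    D (next^[i] u) = D u - i := by
  induction i with
  | zero => rfl
  | succ i ih =>
    have hD := ih (by omega)
    have := (h.next_spec (next^[i] u) (by omega) (by omega)).2.2
    rw [Function.iterate_succ_apply']
    omega

theorem iterate_depth (h : IsBFSTree G B w N k D next) (hu : D u < N) : next^[D u] u = w :=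
  (h.eq_zero_iff _).1 (by rw [h.depth_iterate hu le_rfl, Nat.sub_self])

theorem mem_iterate (h : IsBFSTree G B w N k D next) (hw : B w) (hu : D u < N) {i : ℕ}
    (hi : i ≤ D u) : B (next^[i] u) := by
  rcases hi.eq_or_lt with rfl | hlt
  · rwa [h.iterate_depth hu]
  · have hD := h.depth_iterate hu hi
    exact (h.next_spec _ (by omega) (by omega)).1

theorem adj_iterate (h : IsBFSTree G B w N k D next) (hu : D u < N) {i : ℕ} (hi : i < D u) :
    G.Adj (next^[i] u) (next^[i + 1] u) := by
  have hD := h.depth_iterate hu hi.le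
  rw [Function.iterate_succ_apply']
  exact (h.next_spec _ (by omega) (by omega)).2.1

theorem isInducedPath (h : IsBFSTree G B w N N D next) (hw : B w) (hu : D u < N) :
    IsInducedPath G (D u) (fun i => next^[i] u) where
  injOn i hi j hj e := by
    have hDi := h.depth_iterate hu hi
    have hDj := h.depth_iterate hu hj
    have := hDi.symm.trans ((congrArg D e).trans hDj)
    omega
  adj_iff i hi j hj := by
    refine ⟨fun hadj => ?_, ?_⟩
    · have hDi := h.depth_iterate hu hi
      have hDj := h.depth_iterate hu hj
      have hij := h.le_succ _ _ (h.mem_iterate hw hu hi) hadj (by omega)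
      have hji := h.le_succ _ _ (h.mem_iterate hw hu hj) hadj.symm (by omega)
      have hne : i ≠ j := fun e => hadj.ne (by rw [e])
      omega
    · rintro (rfl | rfl)
      · exact h.adj_iterate hu hj
      · exact (h.adj_iterate hu hi).symm

theorem depth_le (h : IsBFSTree G B w N N D next) {m : ℕ} (hm : m < N) {b : ℕ → V} (hb : b m = w)
    (hB : ∀ i < m, B (b i)) (hadj : ∀ i < m, G.Adj (b i) (b (i + 1))) : D (b 0) ≤ m := by
  suffices ∀ i ≤ m, D (b (m - i)) ≤ i by simpa using this m le_rfl
  intro i hi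
  induction i with
  | zero => simp [(h.eq_zero_iff _).2 hb]
  | succ i ih =>
    have hD := ih (by omega)
    have hstep := hadj (m - (i + 1)) (by omega)
    rw [show m - (i + 1) + 1 = m - i by omega] at hstep
    have := h.le_succ _ _ (hB _ (by omega)) hstep (by omega)
    omega

end IsBFSTree

/-- The vertices that may lie on the path of an AW with shallow terminal `s`, centers `c₁`, `c₂` and
base terminals `u`, `w`. -/
def PathVertex {V : Type*} (G : SimpleGraph V) (s c₁ c₂ u w v : V) : Prop :=
  v = u ∨ v = w ∨ G.Adj c₁ v ∧ G.Adj c₂ v ∧ ¬ G.Adj s v ∧ v ≠ s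

/-- The conditions on the centers and base terminals of an AW that do not involve its base. -/
structure IsFrame {V : Type*} (G : SimpleGraph V) (s c₁ c₂ u w : V) : Prop where
  s_c₁ : G.Adj s c₁
  s_c₂ : G.Adj s c₂
  s_u : ¬ G.Adj s u
  s_w : ¬ G.Adj s w
  c₁_w : ¬ G.Adj c₁ w
  c₂_u : ¬ G.Adj c₂ u
  centers : c₁ = c₂ ∨ G.Adj c₁ c₂ ∧ G.Adj c₁ u ∧ G.Adj c₂ w

namespace IsAW

variable {V : Type*} {G : SimpleGraph V} {s c₁ c₂ : V} {d N : ℕ} {b : ℕ → V} {D : V → ℕ}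
  {next : V → V}

theorem isFrame (h : IsAW G s c₁ c₂ d b) : IsFrame G s c₁ c₂ (b 0) (b (d + 1)) where
  s_c₁ := h.s_c₁
  s_c₂ := h.s_c₂
  s_u := h.s_b 0 (by omega)
  s_w := h.s_b _ le_rfl
  c₁_w := h.c₁_last
  c₂_u := h.c₂_first
  centers := h.centers

theorem pathVertex (h : IsAW G s c₁ c₂ d b) {i : ℕ} (hi : i ≤ d) :
    PathVertex G s c₁ c₂ (b 0) (b (d + 1)) (b i) := by
  rcases Nat.eq_zero_or_pos i with rfl | h1
  · exact .inl rfl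
  · exact .inr (.inr
      ⟨h.c₁_b i h1 hi, h.c₂_b i h1 hi, h.s_b i (by omega), (h.s_ne_b (by omega)).symm⟩)

theorem of_isBFSTree {u w : V} (h : IsBFSTree G (PathVertex G s c₁ c₂ u w) w N N D next)
    (hF : IsFrame G s c₁ c₂ u w) (hd : D u = d + 1) (hN : D u < N) :
    IsAW G s c₁ c₂ d (fun i => next^[i] u) := by
  have hlast : next^[d + 1] u = w := hd ▸ h.iterate_depth hN
  have hpath := h.isInducedPath (.inr (.inl rfl)) hN
  rw [hd] at hpath
  have hinner : ∀ i, 1 ≤ i → i ≤ d →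
      G.Adj c₁ (next^[i] u) ∧ G.Adj c₂ (next^[i] u) ∧ ¬ G.Adj s (next^[i] u) := by
    intro i h1 hi
    rcases h.mem_iterate (.inr (.inl rfl)) hN (i := i) (by omega) with hu | hw | ⟨hc₁, hc₂, hs, -⟩
    · have := hpath.injOn i (by omega) 0 (by omega) hu
      omega
    · have := hpath.injOn i (by omega) (d + 1) le_rfl (hw.trans hlast.symm)
      omega
    · exact ⟨hc₁, hc₂, hs⟩
  exact
    { path := hpath
      s_c₁ := hF.s_c₁
      s_c₂ := hF.s_c₂
      s_b := fun i hi => by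
        rcases Nat.eq_zero_or_pos i with rfl | h1
        · exact hF.s_u
        rcases hi.eq_or_lt with rfl | hlt
        · exact hlast ▸ hF.s_w
        · exact (hinner i h1 (by omega)).2.2
      c₁_b := fun i h1 hi => (hinner i h1 hi).1
      c₂_b := fun i h1 hi => (hinner i h1 hi).2.1
      c₁_last := hlast ▸ hF.c₁_w
      c₂_first := hF.c₂_u
      centers := hlast ▸ hF.centers }

theorem depth_le (h : IsAW G s c₁ c₂ d b)
    (hD : IsBFSTree G (PathVertex G s c₁ c₂ (b 0) (b (d + 1))) (b (d + 1)) N N D next)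
    (hN : d + 1 < N) : D (b 0) ≤ d + 1 :=
  hD.depth_le hN rfl (fun _ hi => h.pathVertex (by omega)) fun _ hi => h.path.adj_succ hi

/-- Without the given long AW, the tree might produce a net, or a `†`-AW with `d = 1`, which is not
an AW. -/
theorem four_lt_depth (h : IsAW G s c₁ c₂ d b) (hG : IsReduced G) (hd : 3 ≤ d)
    (hD : IsBFSTree G (PathVertex G s c₁ c₂ (b 0) (b (d + 1))) (b (d + 1)) N N D next)
    (hN : d + 1 < N) : 4 < D (b 0) := by
  have hle := h.depth_le hD hN
  have hne : D (b 0) ≠ 0 := fun e => by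
    have := h.path.injOn 0 (by omega) (d + 1) le_rfl ((hD.eq_zero_iff _).1 e)
    omega
  obtain ⟨d', hd'⟩ := Nat.exists_eq_add_one_of_ne_zero hne
  have hAW := of_isBFSTree hD h.isFrame hd' (by omega)
  have hlast : next^[d' + 1] (b 0) = b (d + 1) := hd' ▸ hD.iterate_depth (by omega)
  have h0 : d' ≠ 0 := by
    rintro rfl
    have hadj := hAW.path.adj_succ (i := 0) (by omega)
    simp only [hlast, Function.iterate_zero_apply, h.path.adj_iff 0 (by omega) _ le_rfl] at hadj
    omega
  have h1 : c₁ = c₂ → d' ≠ 1 := by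
    rintro rfl rfl
    refine h.not_adj_ends hG hd (hAW.c₁_b 1 le_rfl le_rfl) (hAW.s_b 1 (by omega))
      (hAW.path.adj_succ (i := 0) (by omega)).symm ?_
    exact hlast ▸ hAW.path.adj_succ (i := 1) (by omega)
  have := hAW.three_lt_of_isReduced hG (by grind)
  omega

theorem add_two_le_card [Fintype V] (h : IsAW G s c₁ c₂ d b) : d + 2 ≤ Fintype.card V := by
  have : Function.Injective (fun i : Fin (d + 2) => b i) := fun i j e =>
    Fin.ext (h.path.injOn i (by omega) j (by omega) e)
  simpa using Fintype.card_le_of_injective _ this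

end IsAW

namespace Search

open ForProg

/-! ### The search for an AW with the shortest base -/

/- Registers: `0` the size `n`; `1` the shallow terminal; `2`, `3` the centers; `4`, `5` the base
terminals; `6`, `7`, `8` loop counters; `9` the number of edges of the best path so far; `10` the
current vertex of the path that is being written.
Arrays: `0` the adjacency matrix; `1` the output; `2` the offsets of the rows of the matrix; `3` the
depths and `4` the parents in a breadth-first tree. -/

/-- Tests whether the vertices in registers `x` and `y` are adjacent. -/
def adjTest (x y : ℕ) : Expr := .read 0 (.add (.read 2 (.reg x)) (.reg y))

/-- Tests whether the vertex in register `7` is a `PathVertex`. -/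
def vertexTest : Expr :=
  .or (.eq (.reg 7) (.reg 4)) (.or (.eq (.reg 7) (.reg 5))
    (.and (adjTest 2 7) (.and (adjTest 3 7) (.and (.not (adjTest 1 7))
      (.not (.eq (.reg 7) (.reg 1)))))))

/-- Tests whether registers `1` to `5` hold an `IsFrame`. -/
def frameTest : Expr :=
  .and (adjTest 1 2) (.and (adjTest 1 3) (.and (.not (adjTest 1 4)) (.and (.not (adjTest 1 5))
    (.and (.not (adjTest 2 5)) (.and (.not (adjTest 3 4))
      (.or (.eq (.reg 2) (.reg 3)) (.and (adjTest 2 3) (.and (adjTest 2 4) (adjTest 3 5)))))))))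

/-- Computes the row offsets of the adjacency matrix, without multiplication. -/
def rowOffsets : ForProg :=
  .forLoop 7 (.write 2 (.add (.reg 7) (.const 1)) (.add (.read 2 (.reg 7)) (.reg 0)))

/-- Makes every vertex its own parent, at depth `n`. -/
def clearTree : ForProg :=
  .forLoop 7 (.seq (.write 3 (.reg 7) (.reg 0)) (.write 4 (.reg 7) (.reg 7)))

/-- Makes the vertex in register `7` a child of the vertex in register `8`, if the latter is at the
depth in register `6` and the former is not in the tree. -/
def relaxEdge : ForProg :=
  .when (.and vertexTest (.and (adjTest 7 8)
      (.and (.eq (.read 3 (.reg 8)) (.reg 6)) (.eq (.read 3 (.reg 7)) (.reg 0)))))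
    (.seq (.write 3 (.reg 7) (.add (.reg 6) (.const 1))) (.write 4 (.reg 7) (.reg 8)))

/-- Computes a breadth-first tree with the root in register `5`. -/
def explore : ForProg :=
  .seq clearTree (.seq (.write 3 (.reg 5) (.const 0)) (.forLoop 6 (forLoops [7, 8] relaxEdge)))

/-- Writes the vertices on the way from the vertex in register `4` to the root to the output. -/
def writePath : ForProg :=
  .seq (.assign 10 (.reg 4)) (.forLoop 6
    (.seq (.write 1 (.add (.reg 6) (.const 4)) (.reg 10)) (.assign 10 (.read 4 (.reg 10)))))

/-- Writes `d`, the shallow terminal and the centers to the output, and `d + 1` to register `9`. -/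
def writeHeader : ForProg :=
  .seq (.assign 9 (.read 3 (.reg 4))) (.seq (.write 1 (.const 0) (.sub (.reg 9) (.const 1)))
    (.seq (.write 1 (.const 1) (.reg 1)) (.seq (.write 1 (.const 2) (.reg 2))
      (.write 1 (.const 3) (.reg 3)))))

/-- Writes the AW given by the breadth-first tree to the output. -/
def record : ForProg := .seq writeHeader writePath

/-- Records the AW given by a breadth-first tree, if it is long and better than the best so far. -/
def tryFrame : ForProg :=
  .when frameTest (.seq explore
    (.when (.and (.lt (.const 4) (.read 3 (.reg 4))) (.lt (.read 3 (.reg 4)) (.reg 9))) record))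

/-- Tries all choices of the centers and the base terminals. -/
def search : ForProg :=
  .seq rowOffsets (.seq (.assign 9 (.reg 0)) (forLoops [2, 3, 4, 5] tryFrame))

theorem wf_search : search.Wf := by
  simp [search, rowOffsets, tryFrame, explore, clearTree, relaxEdge, record, writeHeader, writePath,
    forLoops, Wf, regs]

theorem zero_notMem_regs_search : 0 ∉ search.regs := by decide

variable {n : ℕ} {G : SimpleGraph (Fin n)} {s c₁ c₂ u w v v' : Fin n} {σ τ : State}

/-- The state holds the input and the row offsets. -/
structure Ctx (G : SimpleGraph (Fin n)) (s : Fin n) (σ : State) : Prop where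
  size : σ.reg 0 = n
  source : σ.reg 1 = s
  adj : ∀ i j : Fin n, σ.arr 0 (σ.arr 2 i + j) ≠ 0 ↔ G.Adj i j

namespace Ctx

theorem of_agree {rs as : List ℕ} (h : Ctx G s σ) (ha : Agree rs as σ τ)
    (hr : ∀ x ≤ 1, x ∉ rs := by decide) (hs : 0 ∉ as ∧ 2 ∉ as := by decide) : Ctx G s τ where
  size := (ha.reg 0 (hr 0 (by decide))).trans h.size
  source := (ha.reg 1 (hr 1 (by decide))).trans h.source
  adj := by rw [ha.arr 0 hs.1, ha.arr 2 hs.2]; exact h.adj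

theorem holds_adjTest (h : Ctx G s σ) {x y : ℕ} (hx : σ.reg x = v) (hy : σ.reg y = v') :
    (adjTest x y).Holds σ ↔ G.Adj v v' := by
  rw [← h.adj, ← hx, ← hy]
  rfl

end Ctx

/-- The state moreover holds the centers and the base terminals. -/
structure Env (G : SimpleGraph (Fin n)) (s c₁ c₂ u w : Fin n) (σ : State) : Prop
    extends Ctx G s σ where
  reg_two : σ.reg 2 = c₁
  reg_three : σ.reg 3 = c₂
  reg_four : σ.reg 4 = u
  reg_five : σ.reg 5 = w

namespace Env

theorem of_agree {rs as : List ℕ} (h : Env G s c₁ c₂ u w σ) (ha : Agree rs as σ τ)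
    (hr : ∀ x ≤ 5, x ∉ rs := by decide) (hs : 0 ∉ as ∧ 2 ∉ as := by decide) :
    Env G s c₁ c₂ u w τ where
  toCtx := h.toCtx.of_agree ha (fun x hx => hr x (by omega)) hs
  reg_two := (ha.reg 2 (hr 2 (by decide))).trans h.reg_two
  reg_three := (ha.reg 3 (hr 3 (by decide))).trans h.reg_three
  reg_four := (ha.reg 4 (hr 4 (by decide))).trans h.reg_four
  reg_five := (ha.reg 5 (hr 5 (by decide))).trans h.reg_five

theorem holds_frameTest (h : Env G s c₁ c₂ u w σ) :
    frameTest.Holds σ ↔ IsFrame G s c₁ c₂ u w := by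
  simp only [frameTest, Expr.holds_and, Expr.holds_or, Expr.holds_not, Expr.holds_eq, Expr.eval,
    h.holds_adjTest h.source h.reg_two, h.holds_adjTest h.source h.reg_three,
    h.holds_adjTest h.source h.reg_four, h.holds_adjTest h.source h.reg_five,
    h.holds_adjTest h.reg_two h.reg_five, h.holds_adjTest h.reg_three h.reg_four,
    h.holds_adjTest h.reg_two h.reg_three, h.holds_adjTest h.reg_two h.reg_four,
    h.holds_adjTest h.reg_three h.reg_five, h.reg_two, h.reg_three, ← Fin.ext_iff]
  exact ⟨fun ⟨a, b, c, d, e, f, g⟩ => ⟨a, b, c, d, e, f, g⟩,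
    fun ⟨a, b, c, d, e, f, g⟩ => ⟨a, b, c, d, e, f, g⟩⟩

theorem holds_vertexTest (h : Env G s c₁ c₂ u w σ) (hv : σ.reg 7 = v) :
    vertexTest.Holds σ ↔ PathVertex G s c₁ c₂ u w v := by
  simp only [vertexTest, Expr.holds_and, Expr.holds_or, Expr.holds_not, Expr.holds_eq, Expr.eval,
    hv, h.reg_four, h.reg_five, h.source, ← Fin.ext_iff, h.holds_adjTest h.source hv,
    h.holds_adjTest h.reg_two hv, h.holds_adjTest h.reg_three hv, PathVertex, ne_eq]

end Env

theorem rowOffsets_arr (σ : State) (h : σ.arr 2 0 = 0) :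
    ∀ i ≤ σ.reg 0, (rowOffsets.run σ).arr 2 i = i * σ.reg 0 := by
  suffices (rowOffsets.run σ).reg 0 = σ.reg 0 ∧
      ∀ i ≤ σ.reg 0, (rowOffsets.run σ).arr 2 i = i * σ.reg 0 from this.2
  refine forLoop_induction (fun k τ => τ.reg 0 = σ.reg 0 ∧ ∀ i ≤ k, τ.arr 2 i = i * σ.reg 0) rfl
    ?_ ?_
  · simp [h]
  · rintro k - τ hk ⟨h0, hrow⟩
    refine ⟨by simpa [run] using h0, fun i hi => ?_⟩
    rcases Nat.le_succ_iff.1 hi with hle | rfl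
    · simpa [run, Expr.eval, hk, show i ≠ k + 1 by omega] using hrow i hle
    · simp [run, Expr.eval, hk, h0, hrow k le_rfl, Nat.succ_mul]

theorem inputState_arr_zero (G : SimpleGraph (Fin n)) (s i j : Fin n) :
    (inputState G s).arr 0 (i * n + j) ≠ 0 ↔ G.Adj i j := by
  have hiff : (∃ i' j' : Fin n, (i : ℕ) * n + j = i' * n + j' ∧ G.Adj i' j') ↔ G.Adj i j := by
    refine ⟨?_, fun h => ⟨i, j, rfl, h⟩⟩
    rintro ⟨i', j', e, hadj⟩
    have hj : (j : ℕ) = j' := by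
      simpa [Nat.mul_add_mod', Nat.mod_eq_of_lt] using congrArg (· % n) e
    have hi : (i : ℕ) = i' := Nat.eq_of_mul_eq_mul_right i.pos (Nat.add_right_cancel (hj ▸ e))
    rwa [Fin.ext hi, Fin.ext hj]
  simp [inputState, hiff]

theorem rowOffsets_spec (G : SimpleGraph (Fin n)) (s : Fin n) :
    Ctx G s (rowOffsets.run (inputState G s)) where
  size := (run_agree rowOffsets _).reg 0 (by decide)
  source := (run_agree rowOffsets _).reg 1 (by decide)
  adj i j := by
    rw [(run_agree rowOffsets _).arr 0 (by decide),
      rowOffsets_arr _ (by simp [inputState]) i i.2.le]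
    exact inputState_arr_zero G s i j

/-- The state holds the depths `D` and the parents `next`. -/
structure Stores (D : Fin n → ℕ) (next : Fin n → Fin n) (σ : State) : Prop where
  depth (v : Fin n) : σ.arr 3 v = D v
  parent (v : Fin n) : σ.arr 4 v = next v

namespace Stores

variable {D : Fin n → ℕ} {next : Fin n → Fin n}

theorem of_agree {rs as : List ℕ} (h : Stores D next σ) (ha : Agree rs as σ τ)
    (hs : 3 ∉ as ∧ 4 ∉ as := by decide) : Stores D next τ where
  depth v := by rw [ha.arr 3 hs.1, h.depth]
  parent v := by rw [ha.arr 4 hs.2, h.parent]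

theorem setDepth (h : Stores D next σ) (v : Fin n) (k : ℕ) :
    Stores (Function.update D v k) next (σ.setCell 3 v k) where
  depth x := by simp [Function.update_apply, Fin.ext_iff, h.depth]
  parent x := by simp [h.parent]

theorem setParent (h : Stores D next σ) (v v' : Fin n) :
    Stores D (Function.update next v v') (σ.setCell 4 v v') where
  depth x := by simp [h.depth]
  parent x := by
    by_cases hx : x = v
    · simp [hx]
    · simp [hx, h.parent, Fin.val_inj]

end Stores

theorem clearTree_spec (hn : σ.reg 0 = n) :
    Stores (fun _ : Fin n => n) id (clearTree.run σ) := by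
  suffices (clearTree.run σ).reg 0 = n ∧ ∀ v : Fin n, (v : ℕ) < n →
      (clearTree.run σ).arr 3 v = n ∧ (clearTree.run σ).arr 4 v = v from
    ⟨fun v => (this.2 v v.2).1, fun v => (this.2 v v.2).2⟩
  refine forLoop_induction (fun k τ => τ.reg 0 = n ∧ ∀ v : Fin n, (v : ℕ) < k →
    τ.arr 3 v = n ∧ τ.arr 4 v = v) hn (by simp [hn]) ?_
  rintro k - τ hk ⟨h0, hcell⟩
  refine ⟨by simpa [run] using h0, fun v hv => ?_⟩
  rcases Nat.lt_succ_iff_lt_or_eq.1 hv with hlt | rfl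
  · simpa [run, Expr.eval, hk, hlt.ne] using hcell v hlt
  · simp [run, Expr.eval, hk, h0]

/-- The state holds a breadth-first tree with root `w`, explored up to depth `k`. -/
def Explored (G : SimpleGraph (Fin n)) (s c₁ c₂ u w : Fin n) (k : ℕ) (σ : State) : Prop :=
  Env G s c₁ c₂ u w σ ∧ ∃ D next, Stores D next σ ∧
    IsBFSTree G (PathVertex G s c₁ c₂ u w) w n k D next

theorem Explored.of_agree {k : ℕ} {rs as : List ℕ} (h : Explored G s c₁ c₂ u w k σ)
    (ha : Agree rs as σ τ) (hr : ∀ x ≤ 5, x ∉ rs := by decide)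
    (hs : ∀ a ∈ [0, 2, 3, 4], a ∉ as := by decide) : Explored G s c₁ c₂ u w k τ := by
  obtain ⟨hE, D, next, hS, hT⟩ := h
  simp only [List.forall_mem_cons] at hs
  exact ⟨hE.of_agree ha hr ⟨hs.1, hs.2.1⟩, D, next, hS.of_agree ha ⟨hs.2.2.1, hs.2.2.2.1⟩, hT⟩

/-- The edge between `v` and `v'` makes `v` a child of `v'` at depth `k + 1`. -/
def CanRelax (G : SimpleGraph (Fin n)) (s c₁ c₂ u w : Fin n) (k : ℕ) (v v' : Fin n)
    (σ : State) : Prop :=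
  PathVertex G s c₁ c₂ u w v ∧ G.Adj v v' ∧ σ.arr 3 v' = k ∧ σ.arr 3 v = n

section relaxEdge

variable {k : ℕ}

open Classical in
theorem relaxEdge_run (hE : Env G s c₁ c₂ u w σ) (h6 : σ.reg 6 = k) (h7 : σ.reg 7 = v)
    (h8 : σ.reg 8 = v') : relaxEdge.run σ = if CanRelax G s c₁ c₂ u w k v v' σ then
      (σ.setCell 3 v (k + 1)).setCell 4 v v' else σ := by
  have htest : (Expr.and vertexTest (.and (adjTest 7 8) (.and (.eq (.read 3 (.reg 8)) (.reg 6))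
      (.eq (.read 3 (.reg 7)) (.reg 0))))).Holds σ ↔ CanRelax G s c₁ c₂ u w k v v' σ := by
    simp only [Expr.holds_and, Expr.holds_eq, hE.holds_vertexTest h7, hE.holds_adjTest h7 h8,
      Expr.eval, h6, h7, h8, hE.size, CanRelax]
  simp only [relaxEdge, run, htest, Expr.eval, State.setCell_reg, h6, h7, h8]

theorem Explored.run_relaxEdge (h : Explored G s c₁ c₂ u w k σ) (hk : k < n) (h6 : σ.reg 6 = k)
    (h7 : σ.reg 7 = v) (h8 : σ.reg 8 = v') : Explored G s c₁ c₂ u w k (relaxEdge.run σ) := by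
  refine ⟨h.1.of_agree (run_agree _ _), ?_⟩
  obtain ⟨hE, D, next, hS, hT⟩ := h
  rw [relaxEdge_run hE h6 h7 h8]
  split_ifs with hrelax
  · obtain ⟨hv, hadj, hdepth', hdepth⟩ := hrelax
    exact ⟨_, _, (hS.setDepth v _).setParent v v',
      hT.insert hv hadj (by rw [← hS.depth, hdepth']) (by rw [← hS.depth, hdepth]) hk⟩
  · exact ⟨D, next, hS, hT⟩

/-- The edge between `v` and `v'` needs no further attention at depth `k`. -/
def Relaxed (G : SimpleGraph (Fin n)) (s c₁ c₂ u w : Fin n) (k : ℕ) (v v' : Fin n)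
    (σ : State) : Prop :=
  PathVertex G s c₁ c₂ u w v → G.Adj v v' → σ.arr 3 v' = k → σ.arr 3 v ≤ k + 1

theorem Explored.relaxed_run_relaxEdge (h : Explored G s c₁ c₂ u w k σ) (h6 : σ.reg 6 = k)
    (h7 : σ.reg 7 = v) (h8 : σ.reg 8 = v') :
    Relaxed G s c₁ c₂ u w k v v' (relaxEdge.run σ) := by
  obtain ⟨hE, D, next, hS, hT⟩ := h
  intro hv hadj
  rw [relaxEdge_run hE h6 h7 h8]
  split_ifs with hrelax
  · simp
  · intro hk
    rw [hS.depth]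
    exact (hT.le_or_eq v).resolve_right fun hN =>
      hrelax ⟨hv, hadj, hk, (hS.depth v).trans hN⟩

theorem Relaxed.run_relaxEdge {x x' : Fin n} (h : Relaxed G s c₁ c₂ u w k x x' σ)
    (hE : Env G s c₁ c₂ u w σ) (h6 : σ.reg 6 = k) (h7 : σ.reg 7 = v) (h8 : σ.reg 8 = v') :
    Relaxed G s c₁ c₂ u w k x x' (relaxEdge.run σ) := by
  rw [relaxEdge_run hE h6 h7 h8]
  split_ifs
  · intro hx hadj
    have := h hx hadj
    simp only [State.setCell_arr, Function.update_of_ne (show 3 ≠ 4 by decide),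
      Function.update_self, Function.update_apply]
    split_ifs <;> omega
  · exact h

theorem isLoopInvariant_explored (hk : k < n) : IsLoopInvariant n [7, 8] relaxEdge
    (fun τ => Explored G s c₁ c₂ u w k τ ∧ τ.reg 6 = k) where
  size τ hτ := hτ.1.1.size
  setReg x hx j τ hτ := by
    have hx5 : 6 < x := by rcases List.mem_pair.1 hx with rfl | rfl <;> decide
    refine ⟨hτ.1.of_agree (.setReg x j) (fun y hy => ?_), ?_⟩
    · simpa using by omega
    · simpa [hx5.ne] using hτ.2
  run τ hτ hlt := ⟨hτ.1.run_relaxEdge (v := ⟨_, hlt 7 (by simp)⟩) (v' := ⟨_, hlt 8 (by simp)⟩)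
    hk hτ.2 rfl rfl, ((run_agree relaxEdge τ).reg 6 (by decide)).trans hτ.2⟩

theorem isLoopInvariant_relaxed (hk : k < n) (v v' : Fin n) : IsLoopInvariant n [7, 8] relaxEdge
    (fun τ => (Explored G s c₁ c₂ u w k τ ∧ τ.reg 6 = k) ∧ Relaxed G s c₁ c₂ u w k v v' τ) where
  size τ hτ := (isLoopInvariant_explored hk).size τ hτ.1
  setReg x hx j τ hτ := ⟨(isLoopInvariant_explored hk).setReg x hx j τ hτ.1, hτ.2⟩
  run τ hτ hlt := ⟨(isLoopInvariant_explored hk).run τ hτ.1 hlt,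
    hτ.2.run_relaxEdge (v := ⟨_, hlt 7 (by simp)⟩) (v' := ⟨_, hlt 8 (by simp)⟩)
      hτ.1.1.1 hτ.1.2 rfl rfl⟩

theorem Explored.run_forLoops (h : Explored G s c₁ c₂ u w k σ) (hk : k < n) (h6 : σ.reg 6 = k) :
    Explored G s c₁ c₂ u w (k + 1) ((forLoops [7, 8] relaxEdge).run σ) := by
  have hI := isLoopInvariant_explored (G := G) (s := s) (c₁ := c₁) (c₂ := c₂) (u := u) (w := w) hk
  have hdisj : List.Disjoint [7, 8] relaxEdge.regs := by simp [relaxEdge, regs]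
  obtain ⟨hE, D, next, hS, hT⟩ := (hI.forLoops (by decide) hdisj ⟨h, h6⟩).1
  refine ⟨hE, D, next, hS, hT.succ fun v v' hv hadj hdepth => ?_⟩
  rw [← hS.depth] at hdepth ⊢
  exact hI.forLoops_visit (isLoopInvariant_relaxed hk v v') (by decide) hdisj
    (fun x => if x = 7 then v else v') (by simp)
    (fun τ hτ hν => hτ.1.relaxed_run_relaxEdge hτ.2 (by simpa using hν 7 (by simp))
      (by simpa using hν 8 (by simp))) ⟨h, h6⟩ hv hadj hdepth

end relaxEdge

theorem explore_spec (hE : Env G s c₁ c₂ u w σ) :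
    Explored G s c₁ c₂ u w n (explore.run σ) := by
  have hE' := hE.of_agree (run_agree clearTree σ)
  have hroot : Explored G s c₁ c₂ u w 0 ((ForProg.write 3 (.reg 5) (.const 0)).run
      (clearTree.run σ)) := by
    refine ⟨hE'.of_agree (run_agree _ _), _, _, ?_, .root w.pos⟩
    simpa only [run, Expr.eval, hE'.reg_five] using (clearTree_spec hE.size).setDepth w 0
  refine forLoop_induction (fun k τ => Explored G s c₁ c₂ u w k τ) hroot.1.size
    (hroot.of_agree (.setReg 6 0)) fun k hk τ h6 hτ => ?_
  exact (hτ.run_forLoops hk h6).of_agree (.setReg 6 (k + 1))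

theorem writePath_spec {next : Fin n → Fin n} (hnext : ∀ v : Fin n, σ.arr 4 v = next v)
    (h4 : σ.reg 4 = u) :
    (∀ k < 4, (writePath.run σ).arr 1 k = σ.arr 1 k) ∧
      ∀ k < σ.reg 0, (writePath.run σ).arr 1 (k + 4) = (next^[k] u : Fin n) := by
  suffices (∀ v : Fin n, (writePath.run σ).arr 4 v = next v) ∧
      (writePath.run σ).reg 10 = (next^[σ.reg 0] u : Fin n) ∧
      (∀ k < 4, (writePath.run σ).arr 1 k = σ.arr 1 k) ∧
      ∀ k < σ.reg 0, (writePath.run σ).arr 1 (k + 4) = (next^[k] u : Fin n) from this.2.2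
  refine forLoop_induction (n := σ.reg 0) (fun i τ => (∀ v : Fin n, τ.arr 4 v = next v) ∧
    τ.reg 10 = (next^[i] u : Fin n) ∧ (∀ k < 4, τ.arr 1 k = σ.arr 1 k) ∧
    ∀ k < i, τ.arr 1 (k + 4) = (next^[k] u : Fin n)) (by simp [run]) ?_ ?_
  · simpa [run, Expr.eval, h4] using hnext
  rintro i - τ h6 ⟨hnext', h10, hlow, hpath⟩
  refine ⟨by simpa [run] using hnext', ?_, fun k hk => ?_, fun k hk => ?_⟩
  · simp [run, Expr.eval, h10, hnext', Function.iterate_succ_apply']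
  · simpa [run, Expr.eval, h6, show k ≠ i + 4 by omega] using hlow k hk
  · rcases Nat.lt_succ_iff_lt_or_eq.1 hk with hlt | rfl
    · simpa [run, Expr.eval, h6, hlt.ne] using hpath k hlt
    · simp [run, Expr.eval, h6, h10]

theorem outputs_toList {W : LongAW G} (hd : σ.arr 1 0 = W.d)
    (hs : σ.arr 1 1 = W.shallowTerminal) (hc₁ : σ.arr 1 2 = W.c₁) (hc₂ : σ.arr 1 3 = W.c₂)
    (hpath : ∀ i : Fin (W.d + 2), σ.arr 1 (i + 4) = W.path i) : σ.Outputs W.toList := by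
  rintro ⟨i, hi⟩
  match i, hi with
  | 0, _ => exact hd
  | 1, _ => exact hs
  | 2, _ => exact hc₁
  | 3, _ => exact hc₂
  | k + 4, hk =>
    have hk' : k < W.d + 2 := by simpa [LongAW.toList, Nat.lt_succ_iff] using hk
    simpa only [LongAW.toList, List.get_eq_getElem, List.cons_append, List.nil_append,
      List.getElem_cons_succ, List.getElem_ofFn] using hpath ⟨k, hk'⟩

/-- Register `9` holds `n` if no AW has been found, and otherwise the number of edges of the path of
the AW in the output. -/
def RecordsAW (G : SimpleGraph (Fin n)) (s : Fin n) (σ : State) : Prop :=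
  σ.reg 9 = n ∨
    ∃ W : LongAW G, W.shallowTerminal = s ∧ σ.reg 9 = W.d + 1 ∧ σ.Outputs W.toList

theorem RecordsAW.reg_nine_le (h : RecordsAW G s σ) : σ.reg 9 ≤ n := by
  rcases h with h | ⟨W, -, h, -⟩
  · exact h.le
  · have := W.isAW.add_two_le_card
    rw [Fintype.card_fin] at this
    omega

theorem RecordsAW.of_agree {rs as : List ℕ} (h : RecordsAW G s σ) (ha : Agree rs as σ τ)
    (hr : 9 ∉ rs := by decide) (hs : 1 ∉ as := by decide) : RecordsAW G s τ := by
  simpa only [RecordsAW, State.Outputs, ha.reg 9 hr, ha.arr 1 hs] using h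

theorem record_reg_nine (σ : State) : (record.run σ).reg 9 = σ.arr 3 (σ.reg 4) := by
  rw [record, run, (run_agree writePath _).reg 9 (by decide)]
  simp [writeHeader, run, Expr.eval]

theorem record_spec (h : Explored G s c₁ c₂ u w n σ) (hF : IsFrame G s c₁ c₂ u w)
    (hlong : 4 < σ.arr 3 u) (hlt : σ.arr 3 u < n) : RecordsAW G s (record.run σ) := by
  obtain ⟨hE, D, next, hS, hT⟩ := h
  obtain ⟨d, hd⟩ : ∃ d, D u = d + 1 := Nat.exists_eq_add_one_of_ne_zero (by rw [← hS.depth]; omega)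
  rw [hS.depth, hd] at hlong hlt
  obtain ⟨W, rfl, hWs, hW₁, hW₂, hWp⟩ :=
    (IsAW.of_isBFSTree hT hF hd (hd ▸ hlt)).exists_longAW (by omega)
  refine .inr ⟨W, hWs, by rw [record_reg_nine, hE.reg_four, hS.depth, hd], ?_⟩
  have ha := run_agree writeHeader σ
  obtain ⟨hlow, hpath⟩ := writePath_spec (σ := writeHeader.run σ) (next := next) (u := u)
    (fun v => by rw [ha.arr 4 (by decide), hS.parent])
    (by rw [ha.reg 4 (by decide), hE.reg_four])
  rw [ha.reg 0 (by decide), hE.size] at hpath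
  have hdepth : σ.arr 3 (σ.reg 4) = W.d + 1 := by rw [hE.reg_four, hS.depth, hd]
  refine outputs_toList ((hlow 0 (by decide)).trans ?_) ((hlow 1 (by decide)).trans ?_)
    ((hlow 2 (by decide)).trans ?_) ((hlow 3 (by decide)).trans ?_) fun i => ?_
  · simp [writeHeader, run, Expr.eval, hdepth]
  · simp [writeHeader, run, Expr.eval, hE.source, hWs]
  · simp [writeHeader, run, Expr.eval, hE.reg_two, hW₁]
  · simp [writeHeader, run, Expr.eval, hE.reg_three, hW₂]
  · rw [hWp]
    exact hpath i (by omega)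

theorem tryFrame_reg_nine_le (σ : State) : (tryFrame.run σ).reg 9 ≤ σ.reg 9 := by
  have h9 := (run_agree explore σ).reg 9 (by decide)
  simp only [tryFrame, run, Expr.holds_and, Expr.holds_lt, Expr.eval]
  split_ifs with _ hlt
  · rw [record_reg_nine]
    omega
  · exact h9.le
  · exact le_rfl

theorem RecordsAW.run_tryFrame (h : RecordsAW G s σ) (hE : Env G s c₁ c₂ u w σ) :
    RecordsAW G s (tryFrame.run σ) := by
  have hexp := explore_spec hE
  have h' := h.of_agree (run_agree explore σ)
  simp only [tryFrame, run, Expr.holds_and, Expr.holds_lt, Expr.eval, hexp.1.reg_four]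
  split_ifs with hF hlt
  · exact record_spec hexp (hE.holds_frameTest.1 hF) hlt.1 (hlt.2.trans_le h'.reg_nine_le)
  · exact h'
  · exact h

theorem tryFrame_reg_nine_le_of_isAW (hG : IsReduced G) {d : ℕ} {b : ℕ → Fin n}
    (hAW : IsAW G s c₁ c₂ d b) (hd : 3 ≤ d) (hE : Env G s c₁ c₂ (b 0) (b (d + 1)) σ) :
    (tryFrame.run σ).reg 9 ≤ d + 1 := by
  have hcard := hAW.add_two_le_card
  rw [Fintype.card_fin] at hcard
  obtain ⟨hE', D, next, hS, hT⟩ := explore_spec hE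
  have hlong := hAW.four_lt_depth hG hd hT (by omega)
  have hle := hAW.depth_le hT (by omega)
  simp only [tryFrame, run, Expr.holds_and, Expr.holds_lt, Expr.eval,
    if_pos (hE.holds_frameTest.2 hAW.isFrame), hE'.reg_four, hS.depth]
  split_ifs with hlt
  · rwa [record_reg_nine, hE'.reg_four, hS.depth]
  · omega

theorem Ctx.exists_env (h : Ctx G s σ) (hlt : ∀ x ∈ [2, 3, 4, 5], σ.reg x < n) :
    ∃ c₁ c₂ u w, Env G s c₁ c₂ u w σ :=
  ⟨⟨_, hlt 2 (by simp)⟩, ⟨_, hlt 3 (by simp)⟩, ⟨_, hlt 4 (by simp)⟩, ⟨_, hlt 5 (by simp)⟩,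
    h, rfl, rfl, rfl, rfl⟩

theorem isLoopInvariant_recordsAW (G : SimpleGraph (Fin n)) (s : Fin n) :
    IsLoopInvariant n [2, 3, 4, 5] tryFrame (fun τ => Ctx G s τ ∧ RecordsAW G s τ) where
  size τ hτ := hτ.1.size
  setReg x hx i τ hτ := by
    have hx' : 2 ≤ x ∧ x ≤ 5 := by
      simp only [List.mem_cons, List.not_mem_nil, or_false] at hx
      omega
    exact ⟨hτ.1.of_agree (.setReg x i) (fun y hy => by simpa using by omega),
      hτ.2.of_agree (.setReg x i) (by simpa using by omega)⟩
  run τ hτ hlt := by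
    obtain ⟨c₁, c₂, u, w, hE⟩ := hτ.1.exists_env hlt
    exact ⟨hτ.1.of_agree (run_agree tryFrame τ), hτ.2.run_tryFrame hE⟩

theorem isLoopInvariant_reg_nine_le (G : SimpleGraph (Fin n)) (s : Fin n) (m : ℕ) :
    IsLoopInvariant n [2, 3, 4, 5] tryFrame
      (fun τ => (Ctx G s τ ∧ RecordsAW G s τ) ∧ τ.reg 9 ≤ m) where
  size τ hτ := hτ.1.1.size
  setReg x hx i τ hτ := by
    refine ⟨(isLoopInvariant_recordsAW G s).setReg x hx i τ hτ.1, ?_⟩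
    have hx9 : 9 ≠ x := by
      rintro rfl
      simp at hx
    simpa [hx9] using hτ.2
  run τ hτ hlt := ⟨(isLoopInvariant_recordsAW G s).run τ hτ.1 hlt,
    (tryFrame_reg_nine_le τ).trans hτ.2⟩

theorem search_spec (hG : IsReduced G) (s : Fin n) :
    RecordsAW G s (search.run (inputState G s)) ∧
      ∀ W : LongAW G, W.shallowTerminal = s →
        (search.run (inputState G s)).reg 9 ≤ W.d + 1 := by
  have hctx := rowOffsets_spec G s
  have hinit : Ctx G s ((ForProg.assign 9 (.reg 0)).run (rowOffsets.run (inputState G s))) ∧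
      RecordsAW G s ((ForProg.assign 9 (.reg 0)).run (rowOffsets.run (inputState G s))) :=
    ⟨hctx.of_agree (run_agree _ _), .inl hctx.size⟩
  have hI := isLoopInvariant_recordsAW G s
  have hdisj : List.Disjoint [2, 3, 4, 5] tryFrame.regs := by
    simp [tryFrame, explore, clearTree, relaxEdge, record, writeHeader, writePath, forLoops, regs]
  refine ⟨(hI.forLoops (by decide) hdisj hinit).2, fun W hW => ?_⟩
  refine hI.forLoops_visit (isLoopInvariant_reg_nine_le G s (W.d + 1)) (by decide) hdisj
    (fun | 2 => W.c₁ | 3 => W.c₂ | 4 => W.natPath 0 | _ => W.natPath (W.d + 1)) (by simp)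
    (fun τ hτ hν => ?_) hinit
  simp only [List.forall_mem_cons, List.not_mem_nil, false_implies, implies_true, and_true] at hν
  obtain ⟨h2, h3, h4, h5⟩ := hν
  exact tryFrame_reg_nine_le_of_isAW hG (hW ▸ W.isAW) W.three_lt_d.le ⟨hτ.1, h2, h3, h4, h5⟩

theorem exists_isGoodAW_outputs (hG : IsReduced G) (hs : s ∈ ST G) :
    ∃ W : LongAW G, IsGoodAW G s W ∧ (search.run (inputState G s)).Outputs W.toList := by
  obtain ⟨hrec, hmin⟩ := search_spec hG s
  obtain ⟨W₀, hW₀⟩ := hs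
  have hcard := W₀.isAW.add_two_le_card
  have hW₀min := hmin W₀ hW₀
  rw [Fintype.card_fin] at hcard
  obtain ⟨W, rfl, hWd, hout⟩ := hrec.resolve_left (by omega)
  refine ⟨W, LongAW.IsShortest.isGoodAW (fun W' hW' => ?_) hG, hout⟩
  have := hmin W' hW'
  omega

end Search

end IntervalCompletion

theorem mainTheorem10_general :
    (∀ (V : Type*) (G : SimpleGraph V), IntervalCompletion.IsReduced G →
      ∀ s ∈ IntervalCompletion.ST G,
        ∃ W : IntervalCompletion.LongAW G, IntervalCompletion.IsGoodAW G s W) ∧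
    (∃ (P : IntervalCompletion.Prog) (p : Polynomial ℕ),
      ∀ (n : ℕ) (G : SimpleGraph (Fin n)), IntervalCompletion.IsReduced G →
        ∀ s ∈ IntervalCompletion.ST G,
          ∃ (t : ℕ) (σ : IntervalCompletion.State) (W : IntervalCompletion.LongAW G),
            t ≤ p.eval n ∧
            IntervalCompletion.Exec P (IntervalCompletion.inputState G s) t σ ∧
            IntervalCompletion.IsGoodAW G s W ∧ σ.Outputs W.toList) := by
  refine ⟨fun V G hG s hs => IntervalCompletion.exists_isGoodAW hG hs,
    IntervalCompletion.Search.search.compile, IntervalCompletion.Search.search.time,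
    fun n G hG s hs => ?_⟩
  obtain ⟨t, ht, hexec⟩ := IntervalCompletion.ForProg.exec_compile _
    IntervalCompletion.Search.wf_search IntervalCompletion.Search.zero_notMem_regs_search
    (IntervalCompletion.inputState G s)
  obtain ⟨W, hW, hout⟩ := IntervalCompletion.Search.exists_isGoodAW_outputs hG hs
  exact ⟨t, _, W, ht, hexec, hW, hout⟩

theorem mainTheorem10 :
    (∀ (V : Type*) [Finite V] (G : SimpleGraph V), IntervalCompletion.IsReduced G →
      ∀ s ∈ IntervalCompletion.ST G,
        ∃ W : IntervalCompletion.LongAW G, IntervalCompletion.IsGoodAW G s W) ∧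
    (∃ (P : IntervalCompletion.Prog) (p : Polynomial ℕ),
      ∀ (n : ℕ) (G : SimpleGraph (Fin n)), IntervalCompletion.IsReduced G →
        ∀ s ∈ IntervalCompletion.ST G,
          ∃ (t : ℕ) (σ : IntervalCompletion.State) (W : IntervalCompletion.LongAW G),
            t ≤ p.eval n ∧
            IntervalCompletion.Exec P (IntervalCompletion.inputState G s) t σ ∧
            IntervalCompletion.IsGoodAW G s W ∧ σ.Outputs W.toList) :=
  mainTheorem10_general.imp_left fun h V _ => h V
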